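/- Let $m,N$ be integers with $\min\{m,N\}>1$, let $p>1$, and let $W:\mathbb{M}^{m\times N}\to[0,+\infty]$ be a Borel measurable function on the space of real $m\times N$ matrices that is $p$-coercive, i.e. there is $C>0$ with $W(F)\ge C|F|^p$ for all $F\in\mathbb{M}^{m\times N}$. Let $Y=\,]0,1[^N$. For a bounded open set $D\subset\mathbb{R}^N$ let $W^{1,\infty}_0(D;\mathbb{R}^m)$ be the set of all $\varphi\in W^{1,\infty}(D;\mathbb{R}^m)$ that extend continuously to $\overline D$ with $\varphi=0$ on $\partial D$. Let $\mathrm{Aff}_0(Y;\mathbb{R}^m)$ be the set of continuous piecewise affine functions vanishing on $\partial Y$, i.e. of all $\varphi\in W^{1,\infty}_0(Y;\mathbb{R}^m)$ for which there are finitely many pairwise disjoint open sets $V_1,\dots,V_n\subset Y$ (not necessarily connected) with $|\partial V_k|=0$ for all $k$ and $|Y\setminus\bigcup_k V_k|=0$, such that $\nabla\varphi$ is constant a.e. on each $V_k$. For $F\in\mathbb{M}^{m\times N}$ put $$\mathcal{Z}_\infty W(F)=\inf\Big\{\int_Y W(F+\nabla\varphi(y))\,dy:\varphi\in W^{1,\infty}_0(Y;\mathbb{R}^m)\Big\},$$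 $$\mathcal{Z}W(F)=\inf\Big\{\int_Y W(F+\nabla\varphi(y))\,dy:\varphi\in \mathrm{Aff}_0(Y;\mathbb{R}^m)\Big\}.$$ A function $g:\mathbb{M}^{m\times N}\to[0,+\infty]$ is called quasiconvex if it is Borel measurable and $|D|\,g(F)\le\int_D g(F+\nabla\varphi(x))\,dx$ for all $F\in\mathbb{M}^{m\times N}$, all bounded open sets $D\subset\mathbb{R}^N$ with $|\partial D|=0$ and all $\varphi\in W^{1,\infty}_0(D;\mathbb{R}^m)$. Let $\mathcal{Q}W$, the quasiconvex envelope of $W$, be the pointwise supremum of all quasiconvex functions $g\le W$. Theorem A. (1) If $\mathcal{Z}_\infty W(F)<+\infty$ for every $F\in\mathbb{M}^{m\times N}$, then $\mathcal{Q}W$ is itself quasiconvex (so it is the greatest quasiconvex function below $W$), and $\mathcal{Q}W=\mathcal{Z}_\infty W$. (2) If $\mathcal{Z}W(F)<+\infty$ for every $F\in\mathbb{M}^{m\times N}$, then again $\mathcal{Q}W$ is the greatest quasiconvex function below $W$, and $\mathcal{Q}W=\mathcal{Z}W=\mathcal{Z}_\infty W$. -/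

import Mathlib

open MeasureTheory
open scoped ENNReal ContDiff

/-- `ℝ^n` with its Euclidean norm. -/
abbrev Eucl (n : ℕ) : Type := EuclideanSpace ℝ (Fin n)

/-- The space of real `m × N` matrices. -/
abbrev Mat (m N : ℕ) : Type := Matrix (Fin m) (Fin N) ℝ

/-- The space of matrices carries its Borel σ-algebra. -/
instance matMeasurableSpace (m N : ℕ) : MeasurableSpace (Mat m N) := borel _

instance matBorelSpace (m N : ℕ) : BorelSpace (Mat m N) := ⟨rfl⟩

/-- The Euclidean (Frobenius) norm of a matrix. -/
noncomputable def matNorm {m N : ℕ} (F : Mat m N) : ℝ :=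
  Real.sqrt (∑ i, ∑ j, F i j ^ 2)

/-- `W` is `p`-coercive: `W F ≥ C |F|^p` for some constant `C > 0`. -/
def IsPCoercive {m N : ℕ} (p : ℝ) (W : Mat m N → ℝ≥0∞) : Prop :=
  ∃ C : ℝ, 0 < C ∧ ∀ F : Mat m N, ENNReal.ofReal (C * matNorm F ^ p) ≤ W F

/-- The open unit cube `Y = ]0,1[^N`. -/
def unitCube (N : ℕ) : Set (Eucl N) := {x | ∀ i, x i ∈ Set.Ioo (0 : ℝ) 1}

/-- `G` is the weak (distributional) gradient of `φ` in `D`: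
`∫_D φ_i ∂_j ζ = - ∫_D G_{ij} ζ` for all `ζ ∈ C_c^∞(D)`. -/
def HasWeakGradient {m N : ℕ} (D : Set (Eucl N)) (φ : Eucl N → Eucl m)
    (G : Eucl N → Mat m N) : Prop :=
  ∀ ζ : Eucl N → ℝ, ContDiff ℝ ∞ ζ → HasCompactSupport ζ → tsupport ζ ⊆ D →
    ∀ (i : Fin m) (j : Fin N),
      ∫ x in D, φ x i * fderiv ℝ ζ x (EuclideanSpace.single j 1) = -∫ x in D, G x i j * ζ x

/-- `φ` belongs to `W^{1,∞}_0(D; ℝ^m)` and `G` is (a representative of) its gradient: `φ` and its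
weak gradient `G` are in `L^∞(D)`, and `φ` (its continuous representative) vanishes on `∂D`. -/
structure IsW1InftyZero {m N : ℕ} (D : Set (Eucl N)) (φ : Eucl N → Eucl m)
    (G : Eucl N → Mat m N) : Prop where
  memLp : MemLp φ ⊤ (volume.restrict D)
  memLp_grad : ∀ i j, MemLp (fun x => G x i j) ⊤ (volume.restrict D)
  weakGradient : HasWeakGradient D φ G
  continuousOn : ContinuousOn φ (closure D)
  boundary : ∀ x ∈ frontier D, φ x = 0

/-- The gradient field `G` is piecewise constant on `D`: up to a null set, `D` is the union of
finitely many pairwise disjoint open sets with null boundaries (not necessarily connected), on each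
of which `G` is a constant matrix. -/
def IsPiecewiseConstant {m N : ℕ} (D : Set (Eucl N)) (G : Eucl N → Mat m N) : Prop :=
  ∃ (n : ℕ) (V : Fin n → Set (Eucl N)) (ξ : Fin n → Mat m N),
    (∀ k, IsOpen (V k)) ∧ (∀ k, V k ⊆ D) ∧ (∀ k l, k ≠ l → Disjoint (V k) (V l)) ∧
    (∀ k, volume (frontier (V k)) = 0) ∧ volume (D \ ⋃ k, V k) = 0 ∧
    ∀ k, ∀ᵐ x ∂(volume.restrict (V k)), G x = ξ k

/-- `φ ∈ Aff_0(D; ℝ^m)` with gradient `G`: `φ` is a continuous piecewise affine function vanishing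
on `∂D`, that is, `φ ∈ W^{1,∞}_0(D; ℝ^m)` and its gradient is piecewise constant. -/
def IsAffZero {m N : ℕ} (D : Set (Eucl N)) (φ : Eucl N → Eucl m) (G : Eucl N → Mat m N) : Prop :=
  IsW1InftyZero D φ G ∧ IsPiecewiseConstant D G

/-- `Z_∞ W (F) = inf { ∫_Y W(F + ∇φ) : φ ∈ W^{1,∞}_0(Y; ℝ^m) }`. -/
noncomputable def ZInfty {m N : ℕ} (W : Mat m N → ℝ≥0∞) (F : Mat m N) : ℝ≥0∞ :=
  ⨅ (φ : Eucl N → Eucl m) (G : Eucl N → Mat m N) (_ : IsW1InftyZero (unitCube N) φ G),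
    ∫⁻ y in unitCube N, W (F + G y)

/-- `Z W (F) = inf { ∫_Y W(F + ∇φ) : φ ∈ Aff_0(Y; ℝ^m) }`. -/
noncomputable def ZAff {m N : ℕ} (W : Mat m N → ℝ≥0∞) (F : Mat m N) : ℝ≥0∞ :=
  ⨅ (φ : Eucl N → Eucl m) (G : Eucl N → Mat m N) (_ : IsAffZero (unitCube N) φ G),
    ∫⁻ y in unitCube N, W (F + G y)

/-- Quasiconvexity (in the sense of Morrey) of a `[0,∞]`-valued function: `g` is Borel measurable
and `g F ≤ |D|⁻¹ ∫_D g(F + ∇φ)` for every matrix `F`, every bounded open set `D` with null boundary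
and every `φ ∈ W^{1,∞}_0(D; ℝ^m)`. -/
def IsQuasiconvex {m N : ℕ} (g : Mat m N → ℝ≥0∞) : Prop :=
  Measurable g ∧
    ∀ D : Set (Eucl N), IsOpen D → Bornology.IsBounded D → volume (frontier D) = 0 →
      ∀ (F : Mat m N) (φ : Eucl N → Eucl m) (G : Eucl N → Mat m N), IsW1InftyZero D φ G →
        g F * volume D ≤ ∫⁻ x in D, g (F + G x)

/-- The quasiconvex functions lying below `W`. -/
def quasiconvexMinorants {m N : ℕ} (W : Mat m N → ℝ≥0∞) : Set (Mat m N → ℝ≥0∞) :=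
  {g | IsQuasiconvex g ∧ g ≤ W}

/-- The quasiconvex envelope `QW`: the pointwise supremum of the quasiconvex functions below `W`.
It is the greatest such function as soon as there is one. -/
noncomputable def quasiconvexEnvelope {m N : ℕ} (W : Mat m N → ℝ≥0∞) : Mat m N → ℝ≥0∞ :=
  sSup (quasiconvexMinorants W)

/-! Both infima are instances of one functional, `relaxed b W`, over Lipschitz maps vanishing
outside the cube, with finitely many gradients required when `b` holds. Every quasiconvex minorant
of `W` lies below it (`IsQuasiconvex.le_relaxed`), and it lies below `W` (zero test map), so
everything reduces to showing that `relaxed b W` is quasiconvex as soon as it is finite everywhere.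
The equality of the two infima then needs no approximation theorem: both are the quasiconvex
envelope.

By Vitali covering with homothetic copies the infimum may be tested on any bounded open set with
null boundary (`IsTest.transplant`). Along a map with finitely many gradients, quasiconvexity
follows by inserting a nearly optimal test map in each region of constant gradient
(`exists_isTest_refine`).

A general Lipschitz map has to be replaced by one with finitely many gradients, although `W` has no
continuity and no growth bound from above. The tool is `exists_fill`: Lipschitz data outside an open
set extend into it by a map whose gradient entries are all `± 2L`. These gradients form a finite set
depending only on `L`, so `relaxed b W` is bounded on them by a finite `M`, and a filled set costs
at most `M` times its volume (`relaxed_mul_le_of_patch`).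

Filling a thin shell between two affine maps gives continuity of `relaxed b W` (`relaxed_le_add`).
For a Lipschitz map, Rademacher's theorem and Lebesgue differentiation provide finitely many
disjoint balls, covering almost all of the domain, on which the map is replaced by its first-order
expansion and the integral is close to its value at the centre. The rest is filled, with a slope
that does not grow as the error tends to zero (`relaxed_mul_le_of_balls`,
`relaxed_mul_le_of_lipschitz`). -/

open Set Filter Topology
open scoped NNReal

/-! ### Matrices as linear maps, and classical gradients. -/

section MatrixMaps

variable {m N : ℕ}

/-- The continuous linear map `ℝ^N → ℝ^m` with matrix `F`. -/
noncomputable def matCLM (F : Mat m N) : Eucl N →L[ℝ] Eucl m :=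
  LinearMap.toContinuousLinearMap (Matrix.toEuclideanLin F)

/-- The matrix of a continuous linear map `ℝ^N → ℝ^m`. -/
noncomputable def toMat (A : Eucl N →L[ℝ] Eucl m) : Mat m N :=
  Matrix.of fun i j => A (EuclideanSpace.single j 1) i

/-- The matrix of the classical derivative. -/
noncomputable def gradMat (φ : Eucl N → Eucl m) (x : Eucl N) : Mat m N :=
  toMat (fderiv ℝ φ x)

lemma matCLM_apply (F : Mat m N) (x : Eucl N) (i : Fin m) :
    matCLM F x i = ∑ j, F i j * x j := by
  simp [matCLM, Matrix.mulVec, dotProduct]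

lemma toMat_matCLM (F : Mat m N) : toMat (matCLM F) = F := by
  ext i j
  simp [toMat, matCLM_apply]

lemma matCLM_toMat (A : Eucl N →L[ℝ] Eucl m) : matCLM (toMat A) = A := by
  ext x i
  rw [matCLM_apply]
  have hx : x = ∑ j, x j • EuclideanSpace.single j (1 : ℝ) := by
    ext k
    simp [Finset.sum_apply, Pi.single_apply]
  conv_rhs => rw [hx]
  simp [toMat, mul_comm]

lemma toMat_add (A B : Eucl N →L[ℝ] Eucl m) : toMat (A + B) = toMat A + toMat B := by
  ext i j
  simp [toMat]

lemma continuous_toMat : Continuous (toMat : (Eucl N →L[ℝ] Eucl m) → Mat m N) := by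
  refine continuous_matrix fun i j => ?_
  simp only [toMat, Matrix.of_apply]
  exact (EuclideanSpace.proj i : Eucl m →L[ℝ] ℝ).continuous.comp
    (ContinuousLinearMap.apply ℝ (Eucl m) (EuclideanSpace.single j (1 : ℝ))).continuous

lemma continuous_matCLM : Continuous (matCLM : Mat m N → (Eucl N →L[ℝ] Eucl m)) := by
  have : Continuous ((LinearMap.toContinuousLinearMap.toLinearMap.comp
      (Matrix.toEuclideanLin (𝕜 := ℝ) (m := Fin m) (n := Fin N)).toLinearMap :
      Mat m N →ₗ[ℝ] (Eucl N →L[ℝ] Eucl m))) := LinearMap.continuous_of_finiteDimensional _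
  exact this

lemma measurable_gradMat (φ : Eucl N → Eucl m) : Measurable (gradMat φ) :=
  continuous_toMat.measurable.comp (measurable_fderiv ℝ φ)

lemma gradMat_congr {φ ψ : Eucl N → Eucl m} {x : Eucl N} (h : φ =ᶠ[𝓝 x] ψ) :
    gradMat φ x = gradMat ψ x := by
  rw [gradMat, gradMat, h.fderiv_eq]

lemma gradMat_of_affine {φ : Eucl N → Eucl m} {x : Eucl N} {A : Mat m N} {a : Eucl N}
    {b : Eucl m} (h : φ =ᶠ[𝓝 x] fun y => b + matCLM A (y - a)) : gradMat φ x = A := by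
  rw [gradMat_congr h, gradMat]
  have : HasFDerivAt (fun y => b + matCLM A (y - a)) (matCLM A) x := by
    have h1 := (matCLM A).hasFDerivAt (x := x - a)
    have h2 := (hasFDerivAt_id (𝕜 := ℝ) x).sub_const a
    exact (h1.comp x h2).const_add b
  rw [this.fderiv, toMat_matCLM]

lemma gradMat_add {φ ψ : Eucl N → Eucl m} {x : Eucl N}
    (h : DifferentiableAt ℝ φ x) (h' : DifferentiableAt ℝ ψ x) :
    gradMat (fun y => φ y + ψ y) x = gradMat φ x + gradMat ψ x := by
  have : HasFDerivAt (fun y => φ y + ψ y) (fderiv ℝ φ x + fderiv ℝ ψ x) x :=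
    h.hasFDerivAt.add h'.hasFDerivAt
  rw [gradMat, this.fderiv, toMat_add]; rfl

lemma norm_euclidean_coord_le (x : Eucl N) (i : Fin N) : |x i| ≤ ‖x‖ :=
  PiLp.norm_apply_le x i

lemma LipschitzWith.coord {α : Type*} [PseudoMetricSpace α] {φ : α → Eucl m} {L : ℝ≥0}
    (h : LipschitzWith L φ) (i : Fin m) : LipschitzWith L fun x => φ x i := by
  refine LipschitzWith.of_dist_le_mul fun x y => ?_
  rw [Real.dist_eq]
  refine le_trans ?_ (h.dist_le_mul x y)
  rw [dist_eq_norm]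
  exact norm_euclidean_coord_le (φ x - φ y) i

end MatrixMaps

/-! ### Fields with finitely many locally constant values. -/

section PiecewiseConstant

variable {m N : ℕ}

/-- The open set on which `G` is locally almost everywhere equal to `ξ`. -/
def gradRegion (G : Eucl N → Mat m N) (ξ : Mat m N) : Set (Eucl N) :=
  {x | ∃ U ∈ 𝓝 x, ∀ᵐ y ∂volume.restrict U, G y = ξ}

/-- Almost everywhere in `D`, the field `G` is locally constant with value in a fixed finite set. -/
def FinGrad (D : Set (Eucl N)) (G : Eucl N → Mat m N) : Prop :=
  ∃ S : Finset (Mat m N), volume (D \ ⋃ ξ ∈ S, gradRegion G ξ) = 0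

lemma isOpen_gradRegion (G : Eucl N → Mat m N) (ξ : Mat m N) : IsOpen (gradRegion G ξ) := by
  rw [isOpen_iff_mem_nhds]
  rintro x ⟨U, hU, h⟩
  filter_upwards [eventually_mem_nhds_iff.2 hU] with y hy
  exact ⟨U, hy, h⟩

/-- The exceptional set is locally null, hence null because the space is second countable. -/
lemma ae_gradRegion (G : Eucl N → Mat m N) (ξ : Mat m N) :
    ∀ᵐ x ∂volume.restrict (gradRegion G ξ), G x = ξ := by
  rw [ae_restrict_iff' (isOpen_gradRegion G ξ).measurableSet, ae_iff]
  refine measure_null_of_locally_null _ fun x hx => ?_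
  simp only [Classical.not_imp, mem_ofPred_eq] at hx
  obtain ⟨U, hU, h⟩ := hx.1
  obtain ⟨O, hOU, hO, hxO⟩ := mem_nhds_iff.1 hU
  refine ⟨O ∩ {x | ¬ (x ∈ gradRegion G ξ → G x = ξ)}, ?_, ?_⟩
  · rw [inter_comm]
    exact inter_mem_nhdsWithin _ (hO.mem_nhds hxO)
  · have h2 := ae_restrict_of_ae_restrict_of_subset hOU h
    rw [ae_restrict_iff' hO.measurableSet, ae_iff] at h2
    refine measure_mono_null ?_ h2
    rintro y ⟨hy, hy'⟩
    simp only [Classical.not_imp, mem_ofPred_eq] at hy' ⊢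
    exact ⟨hy, hy'.2⟩

/-- The intersection is open, so if it were nonempty it would have positive measure, and `G` would
take two values at almost all of its points. -/
lemma disjoint_gradRegion (G : Eucl N → Mat m N) {ξ η : Mat m N} (h : ξ ≠ η) :
    Disjoint (gradRegion G ξ) (gradRegion G η) := by
  rw [Set.disjoint_iff_inter_eq_empty]
  have hO : IsOpen (gradRegion G ξ ∩ gradRegion G η) :=
    (isOpen_gradRegion G ξ).inter (isOpen_gradRegion G η)
  by_contra hne
  have hpos := hO.measure_pos volume (nonempty_iff_ne_empty.2 hne)
  have h1 := ae_restrict_of_ae_restrict_of_subset inter_subset_left (ae_gradRegion G ξ)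
    (t := gradRegion G ξ) (s := gradRegion G ξ ∩ gradRegion G η)
  have h2 := ae_restrict_of_ae_restrict_of_subset inter_subset_right (ae_gradRegion G η)
    (s := gradRegion G ξ ∩ gradRegion G η)
  have h3 : ∀ᵐ x ∂volume.restrict (gradRegion G ξ ∩ gradRegion G η), False := by
    filter_upwards [h1, h2] with x hx hy
    exact h (hx.symm.trans hy)
  rw [ae_iff] at h3
  simp only [not_false_eq_true, ofPred_true, Measure.restrict_apply_univ] at h3
  exact hpos.ne' h3

lemma gradRegion_congr {D : Set (Eucl N)} (hD : IsOpen D) {G G' : Eucl N → Mat m N}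
    (h : ∀ᵐ x ∂volume.restrict D, G x = G' x) (ξ : Mat m N) :
    D ∩ gradRegion G ξ ⊆ gradRegion G' ξ := by
  rintro x ⟨hx, U, hU, hG⟩
  refine ⟨U ∩ D, inter_mem hU (hD.mem_nhds hx), ?_⟩
  filter_upwards [ae_restrict_of_ae_restrict_of_subset inter_subset_left hG,
    ae_restrict_of_ae_restrict_of_subset inter_subset_right h] with y h1 h2
  rw [← h2, h1]

lemma FinGrad.congr {D : Set (Eucl N)} (hD : IsOpen D) {G G' : Eucl N → Mat m N}
    (hG : FinGrad D G) (h : ∀ᵐ x ∂volume.restrict D, G x = G' x) : FinGrad D G' := by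
  obtain ⟨S, hS⟩ := hG
  refine ⟨S, measure_mono_null ?_ hS⟩
  rintro x ⟨hx, hx'⟩
  refine ⟨hx, fun h2 => hx' ?_⟩
  simp only [mem_iUnion, exists_prop] at h2 ⊢
  obtain ⟨ξ, hξ, h3⟩ := h2
  exact ⟨ξ, hξ, gradRegion_congr hD h ξ ⟨hx, h3⟩⟩

lemma FinGrad.of_isPiecewiseConstant {D : Set (Eucl N)} {G : Eucl N → Mat m N}
    (h : IsPiecewiseConstant D G) : FinGrad D G := by
  classical
  obtain ⟨n, V, ξ, hV, -, -, -, hcov, hG⟩ := h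
  refine ⟨Finset.univ.image ξ, measure_mono_null ?_ hcov⟩
  rintro x ⟨hx, hx'⟩
  refine ⟨hx, fun h2 => hx' ?_⟩
  obtain ⟨k, hk⟩ := mem_iUnion.1 h2
  simp only [mem_iUnion, exists_prop]
  exact ⟨ξ k, by simp, V k, (hV k).mem_nhds hk, hG k⟩

/-- A frontier point inside `D` belongs to no region: not to its own, which is open, and not to
another, which would then meet the first. Such points therefore lie in the null exceptional set. -/
lemma measure_frontier_region {D : Set (Eucl N)} (hfr : volume (frontier D) = 0)
    {G : Eucl N → Mat m N} {S : Finset (Mat m N)}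
    (hS : volume (D \ ⋃ ξ ∈ S, gradRegion G ξ) = 0) (hD : IsOpen D) (ξ : Mat m N) :
    volume (frontier (D ∩ gradRegion G ξ)) = 0 := by
  refine measure_mono_null ?_ (measure_union_null hfr hS)
  intro x hx
  have hop : IsOpen (D ∩ gradRegion G ξ) := hD.inter (isOpen_gradRegion G ξ)
  rw [hop.frontier_eq] at hx
  by_cases hxD : x ∈ D
  · refine Or.inr ⟨hxD, fun h2 => ?_⟩
    simp only [mem_iUnion, exists_prop] at h2
    obtain ⟨η, -, hη⟩ := h2
    have hne : ξ ≠ η := by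
      rintro rfl
      exact hx.2 ⟨hxD, hη⟩
    obtain ⟨y, hy1, hy2⟩ := mem_closure_iff.1 hx.1 _ (isOpen_gradRegion G η) hη
    exact Set.disjoint_left.1 (disjoint_gradRegion G hne) hy2.2 hy1
  · left
    rw [hD.frontier_eq]
    exact ⟨closure_mono inter_subset_left hx.1, hxD⟩

/-- The maximal regions `D ∩ gradRegion G ξ` serve as the pieces. Disjointness and null boundaries
are then automatic, which is why `FinGrad` need not carry them. -/
lemma FinGrad.isPiecewiseConstant {D : Set (Eucl N)} (hD : IsOpen D)
    (hfr : volume (frontier D) = 0) {G : Eucl N → Mat m N} (h : FinGrad D G) :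
    IsPiecewiseConstant D G := by
  obtain ⟨S, hS⟩ := h
  refine ⟨S.card, fun k => D ∩ gradRegion G (S.equivFin.symm k), fun k => S.equivFin.symm k,
    fun k => hD.inter (isOpen_gradRegion G _), fun k => inter_subset_left, ?_,
    fun k => measure_frontier_region hfr hS hD _, ?_, ?_⟩
  · intro k l hkl
    refine (disjoint_gradRegion G ?_).mono inter_subset_right inter_subset_right
    intro h
    exact hkl (S.equivFin.symm.injective (Subtype.ext h))
  · refine measure_mono_null ?_ hS
    rintro x ⟨hx, hx'⟩
    refine ⟨hx, fun h2 => hx' ?_⟩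
    simp only [mem_iUnion, exists_prop] at h2 ⊢
    obtain ⟨ξ, hξ, h3⟩ := h2
    exact ⟨S.equivFin ⟨ξ, hξ⟩, hx, by simpa using h3⟩
  · intro k
    exact ae_restrict_of_ae_restrict_of_subset inter_subset_right (ae_gradRegion G _)

lemma setLIntegral_region {D : Set (Eucl N)} (G : Eucl N → Mat m N) (f : Mat m N → ℝ≥0∞)
    (ξ : Mat m N) :
    ∫⁻ x in D ∩ gradRegion G ξ, f (G x) = f ξ * volume (D ∩ gradRegion G ξ) := by
  rw [← setLIntegral_const]
  refine lintegral_congr_ae ?_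
  filter_upwards [ae_restrict_of_ae_restrict_of_subset inter_subset_right (ae_gradRegion G ξ)]
    with x hx
  rw [hx]

lemma setLIntegral_eq_sum_region {D : Set (Eucl N)} (hD : IsOpen D) {G : Eucl N → Mat m N}
    {S : Finset (Mat m N)} (hS : volume (D \ ⋃ ξ ∈ S, gradRegion G ξ) = 0)
    (f : Eucl N → ℝ≥0∞) :
    ∫⁻ x in D, f x = ∑ ξ ∈ S, ∫⁻ x in D ∩ gradRegion G ξ, f x := by
  rw [← lintegral_biUnion_finset]
  · refine setLIntegral_congr ?_
    rw [← inter_iUnion₂]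
    refine (ae_eq_set.2 ⟨?_, ?_⟩)
    · rw [sdiff_self_inter]; exact hS
    · rw [sdiff_eq_empty.2 inter_subset_left]; exact measure_empty
  · intro ξ _ η _ h
    exact (disjoint_gradRegion G h).mono inter_subset_right inter_subset_right
  · exact fun ξ _ => (hD.inter (isOpen_gradRegion G ξ)).measurableSet

end PiecewiseConstant

/-! ### Gluing Lipschitz maps on disjoint sets. -/

section Glue

/-- If two points do not share a piece, the map of each point's piece vanishes at the other point,
so each value is at most `L * dist x y`; adding the two gives the factor 2. The constant does not
depend on the number of pieces, which may be infinite. -/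
lemma exists_lipschitzWith_glue {α E ι : Type*} [PseudoMetricSpace α] [NormedAddCommGroup E]
    {U : ι → Set α} (hU : Pairwise (Function.onFun Disjoint U)) {ψ : ι → α → E} {L : ℝ≥0}
    (hL : ∀ i, LipschitzWith L (ψ i)) (h0 : ∀ i, ∀ x ∉ U i, ψ i x = 0) :
    ∃ Ψ : α → E, LipschitzWith (2 * L) Ψ ∧ (∀ i, ∀ x ∈ U i, Ψ x = ψ i x) ∧
      ∀ x, (∀ i, x ∉ U i) → Ψ x = 0 := by
  classical
  let Ψ : α → E := fun x => if h : ∃ i, x ∈ U i then ψ h.choose x else 0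
  have hΨ : ∀ i, ∀ x ∈ U i, Ψ x = ψ i x := by
    intro i x hx
    have h : ∃ i, x ∈ U i := ⟨i, hx⟩
    have hi : h.choose = i := by
      by_contra hne
      exact Set.disjoint_left.1 (hU hne) h.choose_spec hx
    simp only [Ψ, dif_pos h, hi]
  have hΨ0 : ∀ x, (∀ i, x ∉ U i) → Ψ x = 0 := by
    intro x hx
    have : ¬ ∃ i, x ∈ U i := by push Not; exact hx
    simp only [Ψ, dif_neg this]
  refine ⟨Ψ, LipschitzWith.of_dist_le_mul fun x y => ?_, hΨ, hΨ0⟩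
  have key : ∀ x y i, x ∈ U i → y ∉ U i → ‖Ψ x‖ ≤ L * dist x y := by
    intro x y i hx hy
    rw [hΨ i x hx, ← sub_zero (ψ i x), ← h0 i y hy, ← dist_eq_norm]
    exact (hL i).dist_le_mul x y
  have hnn : 0 ≤ L * dist x y := by positivity
  have h2 : ((2 * L : ℝ≥0) : ℝ) * dist x y = L * dist x y + L * dist x y := by push_cast; ring
  rw [h2]
  by_cases hx : ∃ i, x ∈ U i
  · obtain ⟨i, hi⟩ := hx
    by_cases hyi : y ∈ U i
    · rw [hΨ i x hi, hΨ i y hyi]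
      linarith [(hL i).dist_le_mul x y]
    · have h1 := key x y i hi hyi
      rw [dist_eq_norm (Ψ x)]
      refine (norm_sub_le _ _).trans (add_le_add h1 ?_)
      by_cases hy : ∃ j, y ∈ U j
      · obtain ⟨j, hj⟩ := hy
        have hxj : x ∉ U j := by
          intro hxj
          have hij : i = j := by
            by_contra hne
            exact Set.disjoint_left.1 (hU hne) hi hxj
          exact hyi (hij ▸ hj)
        rw [dist_comm]
        exact key y x j hj hxj
      · push Not at hy
        rw [hΨ0 y hy, norm_zero]; exact hnn
  · push Not at hx
    rw [hΨ0 x hx, dist_zero_left]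
    by_cases hy : ∃ j, y ∈ U j
    · obtain ⟨j, hj⟩ := hy
      have := key y x j hj (hx j)
      rw [dist_comm] at this
      linarith
    · push Not at hy
      rw [hΨ0 y hy, norm_zero]; linarith

end Glue

/-! ### Lipschitz test maps. -/

section Test

variable {m N : ℕ}

/-- Lipschitz maps vanishing outside `D`, with finitely many gradients if `b` holds. -/
structure IsTest (b : Prop) (D : Set (Eucl N)) (φ : Eucl N → Eucl m) : Prop where
  lip : ∃ L, LipschitzWith L φ
  zero : ∀ x ∉ D, φ x = 0
  fin : b → FinGrad D (gradMat φ)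

lemma abs_gradMat_le {φ : Eucl N → Eucl m} {L : ℝ≥0} (hφ : LipschitzWith L φ) (x : Eucl N)
    (i : Fin m) (j : Fin N) : |gradMat φ x i j| ≤ L := by
  simp only [gradMat, toMat, Matrix.of_apply]
  refine (norm_euclidean_coord_le _ i).trans ?_
  refine ((fderiv ℝ φ x).le_opNorm _).trans ?_
  simpa using norm_fderiv_le_of_lipschitz ℝ hφ (x₀ := x)

/-- Rademacher's theorem together with integration by parts for Lipschitz functions. Since `ζ`
vanishes outside `D`, the integrals may be taken over the whole space. -/
lemma hasWeakGradient_gradMat {φ : Eucl N → Eucl m} {L : ℝ≥0} (hφ : LipschitzWith L φ)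
    (D : Set (Eucl N)) : HasWeakGradient D φ (gradMat φ) := by
  intro ζ hζ hc hs i j
  obtain ⟨K, hK⟩ := ContDiff.lipschitzWith_of_hasCompactSupport hc hζ (by simp)
  have hz : ∀ x ∉ D, ζ x = 0 := fun x hx => image_eq_zero_of_notMem_tsupport fun h => hx (hs h)
  have hz' : ∀ x ∉ D, fderiv ℝ ζ x = 0 := fun x hx =>
    image_eq_zero_of_notMem_tsupport fun h => hx (hs (tsupport_fderiv_subset ℝ h))
  rw [setIntegral_eq_integral_of_forall_compl_eq_zero (fun x hx => by simp [hz' x hx]),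
    setIntegral_eq_integral_of_forall_compl_eq_zero (fun x hx => by simp [hz x hx])]
  have h := LipschitzWith.integral_lineDeriv_mul_eq (μ := volume) (hφ.coord i) hK hc
    (EuclideanSpace.single j (1 : ℝ))
  have hdiff : Differentiable ℝ ζ := hζ.differentiable (by simp)
  have h1 : ∫ x, lineDeriv ℝ (fun x => φ x i) x (EuclideanSpace.single j (1 : ℝ)) * ζ x =
      ∫ x, gradMat φ x i j * ζ x := by
    refine integral_congr_ae ?_
    filter_upwards [hφ.ae_differentiableAt] with x hx
    have h2 : HasFDerivAt (fun x => φ x i)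
        ((EuclideanSpace.proj i : Eucl m →L[ℝ] ℝ).comp (fderiv ℝ φ x)) x :=
      (EuclideanSpace.proj i : Eucl m →L[ℝ] ℝ).hasFDerivAt.comp x hx.hasFDerivAt
    rw [h2.differentiableAt.lineDeriv_eq_fderiv, h2.fderiv]
    simp [gradMat, toMat]
  rw [← h1, h, ← integral_neg]
  refine integral_congr_ae (Eventually.of_forall fun x => ?_)
  dsimp only
  rw [(hdiff x).lineDeriv_eq_fderiv, map_neg]
  ring

lemma IsTest.isW1InftyZero {b : Prop} {D : Set (Eucl N)} (hD : IsOpen D)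
    (hb : Bornology.IsBounded D) {φ : Eucl N → Eucl m} (h : IsTest b D φ) :
    IsW1InftyZero D φ (gradMat φ) := by
  obtain ⟨L, hL⟩ := h.lip
  refine ⟨?_, ?_, hasWeakGradient_gradMat hL D, hL.continuous.continuousOn, ?_⟩
  · obtain ⟨C, hC⟩ := (hb.isCompact_closure.image hL.continuous).isBounded.exists_norm_le
    refine memLp_top_of_bound hL.continuous.aestronglyMeasurable C ?_
    filter_upwards [ae_restrict_mem hD.measurableSet] with x hx
    exact hC _ ⟨x, subset_closure hx, rfl⟩
  · intro i j
    have hm : Measurable fun x => gradMat φ x i j :=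
      ((continuous_id.matrix_elem i j).measurable).comp (measurable_gradMat φ)
    exact memLp_top_of_bound hm.aestronglyMeasurable L
      (Eventually.of_forall fun x => abs_gradMat_le hL x i j)
  · intro x hx
    rw [hD.frontier_eq] at hx
    exact h.zero x hx.2

end Test

/-! ### From bounded weak gradients to Lipschitz maps. -/

section WeakGradient

variable {m N : ℕ}

lemma norm_le_of_forall_single (ℓ : Eucl N →L[ℝ] ℝ) {M : ℝ} (hM : 0 ≤ M)
    (h : ∀ j, |ℓ (EuclideanSpace.single j 1)| ≤ M) : ‖ℓ‖ ≤ N * M := by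
  refine ℓ.opNorm_le_bound (by positivity) fun x => ?_
  have hx : x = ∑ j, x j • EuclideanSpace.single j (1 : ℝ) := by
    ext k
    simp [Finset.sum_apply, Pi.single_apply]
  conv_lhs => rw [hx]
  rw [map_sum]
  refine (norm_sum_le _ _).trans ?_
  calc ∑ j, ‖ℓ (x j • EuclideanSpace.single j (1 : ℝ))‖ ≤ ∑ _j : Fin N, ‖x‖ * M := by
        refine Finset.sum_le_sum fun j _ => ?_
        rw [map_smul, norm_smul]
        exact mul_le_mul (norm_euclidean_coord_le x j) (h j) (norm_nonneg _) (norm_nonneg _)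
    _ = N * M * ‖x‖ := by simp; ring

lemma fderiv_comp_const_sub {ρ : Eucl N → ℝ} (hρ : Differentiable ℝ ρ) (z t v : Eucl N) :
    fderiv ℝ (fun s => ρ (z - s)) t v = -fderiv ℝ ρ (z - t) v := by
  have h : HasFDerivAt (fun s => ρ (z - s)) ((fderiv ℝ ρ (z - t)).comp
      (-ContinuousLinearMap.id ℝ (Eucl N))) t :=
    (hρ (z - t)).hasFDerivAt.comp t ((hasFDerivAt_id t).const_sub z)
  rw [h.fderiv]
  simp

lemma integrable_indicator_coord {D : Set (Eucl N)} (hD : IsOpen D)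
    (hb : Bornology.IsBounded D) {φ : Eucl N → Eucl m}
    (h : MemLp φ ⊤ (volume.restrict D)) (i : Fin m) :
    Integrable (D.indicator fun x => φ x i) := by
  rw [integrable_indicator_iff hD.measurableSet]
  have : IsFiniteMeasure (volume.restrict D) := ⟨by
    rw [Measure.restrict_apply_univ]; exact hb.measure_lt_top⟩
  have h1 : Integrable φ (volume.restrict D) := h.integrable le_top
  exact (EuclideanSpace.proj i : Eucl m →L[ℝ] ℝ).integrable_comp h1

lemma abs_integral_mul_le_of_ae_le {D : Set (Eucl N)} {g ζ : Eucl N → ℝ} {M : ℝ}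
    (hM0 : 0 ≤ M) (hg : ∀ᵐ x ∂volume.restrict D, |g x| ≤ M) (hζ : ∀ x, 0 ≤ ζ x)
    (hζi : Integrable ζ) (hζ1 : ∫ x, ζ x = 1) : |∫ x in D, g x * ζ x| ≤ M := by
  have h1 : ‖∫ x in D, g x * ζ x‖ ≤ ∫ x in D, M * ζ x := by
    refine norm_integral_le_of_norm_le (hζi.integrableOn.const_mul M) ?_
    filter_upwards [hg] with x hx
    rw [norm_mul, Real.norm_eq_abs, Real.norm_eq_abs, abs_of_nonneg (hζ x)]
    exact mul_le_mul_of_nonneg_right hx (hζ x)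
  refine h1.trans ?_
  rw [integral_const_mul]
  have h2 : ∫ x in D, ζ x ≤ ∫ x, ζ x :=
    setIntegral_le_integral hζi (Eventually.of_forall hζ)
  rw [hζ1] at h2
  nlinarith

/-- The reflected bump `ζ t = ρ (z - t)` is supported in `D`, so it is admissible in the weak
formulation. Each partial derivative of the mollification is thus a weighted average of an entry of
`G`. -/
lemma norm_fderiv_mollify_le {D : Set (Eucl N)} (hD : IsOpen D)
    (hb : Bornology.IsBounded D) {φ : Eucl N → Eucl m} {G : Eucl N → Mat m N}
    (h : IsW1InftyZero D φ G) {M : ℝ} (hM0 : 0 ≤ M)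
    (hM : ∀ i j, ∀ᵐ x ∂volume.restrict D, |G x i j| ≤ M) (i : Fin m)
    (b : ContDiffBump (0 : Eucl N)) {z : Eucl N} (hz : Metric.closedBall z b.rOut ⊆ D) :
    DifferentiableAt ℝ (convolution (b.normed volume) (D.indicator fun x => φ x i)
      (ContinuousLinearMap.lsmul ℝ ℝ) volume) z ∧
    ‖fderiv ℝ (convolution (b.normed volume) (D.indicator fun x => φ x i)
      (ContinuousLinearMap.lsmul ℝ ℝ) volume) z‖ ≤ N * M := by
  have hint := integrable_indicator_coord hD hb h.memLp i
  have hcs : HasCompactSupport (b.normed (volume : Measure (Eucl N))) :=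
    b.hasCompactSupport_normed
  have hsm : ContDiff ℝ ∞ (b.normed (volume : Measure (Eucl N))) := b.contDiff_normed
  have hdρ : Differentiable ℝ (b.normed (volume : Measure (Eucl N))) :=
    hsm.differentiable (by simp)
  have hder := hcs.hasFDerivAt_convolution_left (ContinuousLinearMap.lsmul ℝ ℝ)
    (hsm.of_le (by simp)) hint.locallyIntegrable z
  refine ⟨hder.differentiableAt, ?_⟩
  rw [hder.fderiv]
  refine norm_le_of_forall_single _ hM0 fun j => ?_
  set f := D.indicator fun x => φ x i with hf
  set e : Eucl N := EuclideanSpace.single j (1 : ℝ) with he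
  have hcs' := hcs.fderiv (𝕜 := ℝ)
  have hex : ConvolutionExists (fderiv ℝ (b.normed (volume : Measure (Eucl N)))) f
      (ContinuousLinearMap.precompL (Eucl N) (ContinuousLinearMap.lsmul ℝ ℝ)) volume :=
    hcs'.convolutionExists_left _ (hsm.continuous_fderiv (by simp)) hint.locallyIntegrable
  rw [convolution_def, ContinuousLinearMap.integral_apply (hex z)]
  have h1 : ∫ t, ((ContinuousLinearMap.precompL (Eucl N) (ContinuousLinearMap.lsmul ℝ ℝ))
      (fderiv ℝ (b.normed volume) t) (f (z - t))) e =
      ∫ t, fderiv ℝ (b.normed volume) (z - t) e * f t := by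
    rw [← integral_sub_left_eq_self _ volume z]
    refine integral_congr_ae (Eventually.of_forall fun t => ?_)
    simp [ContinuousLinearMap.precompL_apply]
  rw [h1]
  let ζ : Eucl N → ℝ := fun t => b.normed volume (z - t)
  have hζs : tsupport ζ ⊆ Metric.closedBall z b.rOut := by
    refine closure_minimal (fun t ht => ?_) Metric.isClosed_closedBall
    have : z - t ∈ Function.support (b.normed (volume : Measure (Eucl N))) := ht
    rw [b.support_normed_eq, mem_ball_zero_iff] at this
    rw [Metric.mem_closedBall, dist_comm, dist_eq_norm]
    exact this.le
  have hζc : HasCompactSupport ζ :=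
    HasCompactSupport.of_support_subset_isCompact (isCompact_closedBall z b.rOut)
      ((subset_tsupport ζ).trans hζs)
  have hζsm : ContDiff ℝ ∞ ζ := hsm.comp (contDiff_const.sub contDiff_id)
  have hw := h.weakGradient ζ hζsm hζc (hζs.trans hz) i j
  have h2 : ∫ t, fderiv ℝ (b.normed volume) (z - t) e * f t = ∫ x in D, G x i j * ζ x := by
    have h3 : ∫ x in D, φ x i * fderiv ℝ ζ x e =
        -∫ t, fderiv ℝ (b.normed volume) (z - t) e * f t := by
      rw [← integral_indicator hD.measurableSet, ← integral_neg]
      refine integral_congr_ae (Eventually.of_forall fun t => ?_)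
      have h4 := fderiv_comp_const_sub hdρ z t e
      by_cases ht : t ∈ D
      · simp only [indicator_of_mem ht, hf, ζ]
        rw [h4]; ring
      · simp [indicator_of_notMem ht, hf]
    rw [← neg_inj, ← h3, hw]
  rw [h2]
  refine abs_integral_mul_le_of_ae_le hM0 (hM i j) (fun x => b.nonneg_normed _)
    (hζsm.continuous.integrable_of_hasCompactSupport hζc) ?_
  exact (integral_sub_left_eq_self (b.normed volume) volume z).trans b.integral_normed

/-- The mean value inequality holds for the mollifications on a convex set, with a constant
independent of the mollification, and they converge pointwise to the continuous function `φ`. -/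
lemma abs_sub_le_of_ball_subset {D : Set (Eucl N)} (hD : IsOpen D)
    (hb : Bornology.IsBounded D) {φ : Eucl N → Eucl m} {G : Eucl N → Mat m N}
    (h : IsW1InftyZero D φ G) {M : ℝ} (hM0 : 0 ≤ M)
    (hM : ∀ i j, ∀ᵐ x ∂volume.restrict D, |G x i j| ≤ M) (i : Fin m)
    {c : Eucl N} {ρ : ℝ} (hρ : Metric.ball c ρ ⊆ D) {x y : Eucl N} (hx : x ∈ Metric.ball c ρ)
    (hy : y ∈ Metric.ball c ρ) : |φ x i - φ y i| ≤ N * M * dist x y := by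
  let b : ℕ → ContDiffBump (0 : Eucl N) := fun n =>
    ⟨1 / (n + 1 : ℝ) / 2, 1 / (n + 1 : ℝ), by positivity, half_lt_self (by positivity)⟩
  set f := D.indicator fun x => φ x i with hf
  have hint := integrable_indicator_coord hD hb h.memLp i
  have hlim : Tendsto (fun n => (b n).rOut) atTop (𝓝 0) :=
    tendsto_one_div_add_atTop_nhds_zero_nat
  have hconv : ∀ z ∈ D, Tendsto (fun n => convolution ((b n).normed volume) f
      (ContinuousLinearMap.lsmul ℝ ℝ) volume z) atTop (𝓝 (φ z i)) := by
    intro z hz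
    have hcont : ContinuousAt f z := by
      have h1 : ContinuousAt φ z :=
        (h.continuousOn.mono subset_closure).continuousAt (hD.mem_nhds hz)
      have h2 : ContinuousAt (fun x => φ x i) z :=
        (EuclideanSpace.proj i : Eucl m →L[ℝ] ℝ).continuous.continuousAt.comp h1
      refine h2.congr ?_
      filter_upwards [hD.mem_nhds hz] with w hw
      simp [hf, indicator_of_mem hw]
    have h3 : f z = φ z i := by simp [hf, indicator_of_mem hz]
    rw [← h3]
    exact ContDiffBump.convolution_tendsto_right (g := fun _ => f) (k := fun _ => z) hlim
      (Eventually.of_forall fun _ => hint.aestronglyMeasurable)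
      (hcont.tendsto.comp tendsto_snd) tendsto_const_nhds
  -- The closed ball of radius `s < ρ` contains both points and leaves a margin `ρ - s` for the
  -- support of the bump.
  set s := max (dist x c) (dist y c) with hs
  have hsρ : s < ρ := max_lt hx hy
  have hev : ∀ᶠ n in atTop, (b n).rOut < ρ - s :=
    hlim.eventually (gt_mem_nhds (by linarith))
  have hle : ∀ᶠ n in atTop, |convolution ((b n).normed volume) f
      (ContinuousLinearMap.lsmul ℝ ℝ) volume x - convolution ((b n).normed volume) f
      (ContinuousLinearMap.lsmul ℝ ℝ) volume y| ≤ N * M * dist x y := by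
    filter_upwards [hev] with n hn
    have hsub : ∀ z ∈ Metric.closedBall c s, Metric.closedBall z (b n).rOut ⊆ D := by
      intro z hz w hw
      apply hρ
      rw [Metric.mem_closedBall] at hz hw
      rw [Metric.mem_ball]
      linarith [dist_triangle w z c]
    have hder := fun z hz => norm_fderiv_mollify_le hD hb h hM0 hM i (b n) (hsub z hz)
    have := Convex.norm_image_sub_le_of_norm_fderiv_le (𝕜 := ℝ) (s := Metric.closedBall c s)
      (fun z hz => (hder z hz).1) (fun z hz => (hder z hz).2) (convex_closedBall c s)
      (x := y) (y := x) (by simp [hs]) (by simp [hs])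
    rwa [← dist_eq_norm x y] at this
  exact le_of_tendsto (((hconv x (hρ hx)).sub (hconv y (hρ hy))).abs) hle

lemma LipschitzWith.of_coord {α : Type*} [PseudoMetricSpace α] {φ : α → Eucl m} {L : ℝ≥0}
    (h : ∀ i, LipschitzWith L fun x => φ x i) : LipschitzWith (m * L) φ := by
  refine LipschitzWith.of_dist_le_mul fun x y => ?_
  rw [dist_eq_norm, EuclideanSpace.norm_eq]
  rw [Real.sqrt_le_left (by positivity)]
  calc ∑ i, ‖(φ x - φ y) i‖ ^ 2 ≤ ∑ _i : Fin m, (L * dist x y) ^ 2 := by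
        refine Finset.sum_le_sum fun i _ => ?_
        refine pow_le_pow_left₀ (norm_nonneg _) ?_ 2
        have := (h i).dist_le_mul x y
        rwa [dist_eq_norm] at this
    _ = m * (L * dist x y) ^ 2 := by simp
    _ ≤ (((m * L : ℝ≥0) : ℝ) * dist x y) ^ 2 := by
        push_cast
        have h0 : (m : ℝ) ≤ m ^ 2 := by
          exact_mod_cast Nat.le_self_pow (by norm_num) m
        have : 0 ≤ (L * dist x y) ^ 2 := by positivity
        nlinarith

lemma exists_ae_bound {D : Set (Eucl N)} {φ : Eucl N → Eucl m} {G : Eucl N → Mat m N}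
    (h : IsW1InftyZero D φ G) :
    ∃ M : ℝ, 0 ≤ M ∧ ∀ i j, ∀ᵐ x ∂volume.restrict D, |G x i j| ≤ M := by
  have h1 : ∀ i j, ∃ M : ℝ, 0 ≤ M ∧ ∀ᵐ x ∂volume.restrict D, |G x i j| ≤ M := by
    intro i j
    have hm := h.memLp_grad i j
    refine ⟨(eLpNorm (fun x => G x i j) ⊤ (volume.restrict D)).toReal, ENNReal.toReal_nonneg, ?_⟩
    filter_upwards [ae_le_eLpNormEssSup (f := fun x => G x i j) (μ := volume.restrict D)] with x hx
    rw [← eLpNorm_exponent_top] at hx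
    have := ENNReal.toReal_mono hm.eLpNorm_lt_top.ne hx
    simpa using this
  choose M hM0 hM using h1
  refine ⟨∑ i, ∑ j, M i j, Finset.sum_nonneg fun i _ => Finset.sum_nonneg fun j _ => hM0 i j,
    fun i j => ?_⟩
  filter_upwards [hM i j] with x hx
  refine hx.trans ?_
  refine (Finset.single_le_sum (f := fun j => M i j) (fun j _ => hM0 i j)
    (Finset.mem_univ j)).trans ?_
  exact Finset.single_le_sum (f := fun i => ∑ j, M i j)
    (fun i _ => Finset.sum_nonneg fun j _ => hM0 i j) (Finset.mem_univ i)

/-- No regularity of `D` is needed. On the ball about `x` reaching the nearest point of `Dᶜ`, the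
local estimate and the zero boundary value give `|φ x i| ≤ K * infDist x Dᶜ`. For two points of `D`,
either one lies in the other's ball, or their distance dominates both distances to `Dᶜ` and this
decay bounds each value separately. -/
lemma lipschitzWith_indicator {D : Set (Eucl N)} (hD : IsOpen D)
    (hb : Bornology.IsBounded D) (hne : Dᶜ.Nonempty) {φ : Eucl N → Eucl m} {G : Eucl N → Mat m N}
    (h : IsW1InftyZero D φ G) : ∃ L, LipschitzWith L (D.indicator φ) := by
  obtain ⟨M, hM0, hM⟩ := exists_ae_bound h
  set K : ℝ := N * M with hK
  have hK0 : 0 ≤ K := by positivity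
  suffices hs : ∀ i, LipschitzWith (2 * K.toNNReal) fun x => D.indicator φ x i from
    ⟨_, LipschitzWith.of_coord hs⟩
  intro i
  have hball : ∀ c ∈ D, Metric.ball c (Metric.infDist c Dᶜ) ⊆ D := fun c _ =>
    Metric.ball_infDist_compl_subset
  have hpos : ∀ c ∈ D, 0 < Metric.infDist c Dᶜ := fun c hc =>
    (hD.isClosed_compl.notMem_iff_infDist_pos hne).1 (by simpa using hc)
  have hbd : ∀ x ∈ D, |φ x i| ≤ K * Metric.infDist x Dᶜ := by
    intro x hx
    obtain ⟨z, hz, hzd⟩ := hD.isClosed_compl.exists_infDist_eq_dist hne x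
    have hzc : z ∈ closure (Metric.ball x (Metric.infDist x Dᶜ)) := by
      rw [closure_ball _ (hpos x hx).ne', Metric.mem_closedBall, dist_comm, hzd]
    have hzD : z ∈ closure D := closure_mono (hball x hx) hzc
    have hz0 : φ z = 0 := h.boundary z (by rw [hD.frontier_eq]; exact ⟨hzD, hz⟩)
    have hcz : ContinuousWithinAt (fun w => |φ x i - φ w i|)
        (Metric.ball x (Metric.infDist x Dᶜ)) z := by
      have h1 : ContinuousWithinAt φ (Metric.ball x (Metric.infDist x Dᶜ)) z :=
        (h.continuousOn z hzD).mono ((hball x hx).trans subset_closure)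
      have h2 : ContinuousWithinAt (fun w => φ w i) (Metric.ball x (Metric.infDist x Dᶜ)) z :=
        (EuclideanSpace.proj i : Eucl m →L[ℝ] ℝ).continuous.continuousAt.comp_continuousWithinAt h1
      exact (continuousWithinAt_const.sub h2).abs
    have : (𝓝[Metric.ball x (Metric.infDist x Dᶜ)] z).NeBot :=
      mem_closure_iff_nhdsWithin_neBot.1 hzc
    have h3 : |φ x i - φ z i| ≤ K * Metric.infDist x Dᶜ := by
      refine le_of_tendsto hcz ?_
      filter_upwards [self_mem_nhdsWithin] with w hw
      refine (abs_sub_le_of_ball_subset hD hb h hM0 hM i (hball x hx)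
        (Metric.mem_ball_self (hpos x hx)) hw).trans ?_
      refine mul_le_mul_of_nonneg_left ?_ hK0
      rw [dist_comm]
      exact (Metric.mem_ball.1 hw).le
    simpa [hz0] using h3
  refine LipschitzWith.of_dist_le_mul fun x y => ?_
  have hcoe : ((2 * K.toNNReal : ℝ≥0) : ℝ) = 2 * K := by
    push_cast; rw [Real.coe_toNNReal _ hK0]
  rw [hcoe, Real.dist_eq]
  have hd0 : 0 ≤ K * dist x y := by positivity
  by_cases hx : x ∈ D
  · by_cases hy : y ∈ D
    · rw [indicator_of_mem hx, indicator_of_mem hy]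
      rcases lt_or_ge (dist x y) (Metric.infDist x Dᶜ) with hlt | hge
      · have := abs_sub_le_of_ball_subset hD hb h hM0 hM i (hball x hx)
          (Metric.mem_ball_self (hpos x hx)) (y := y) (by rwa [Metric.mem_ball, dist_comm])
        linarith
      · rcases lt_or_ge (dist x y) (Metric.infDist y Dᶜ) with hlt' | hge'
        · have := abs_sub_le_of_ball_subset hD hb h hM0 hM i (hball y hy)
            (x := x) (by rwa [Metric.mem_ball]) (Metric.mem_ball_self (hpos y hy))
          linarith
        · have h1 := mul_le_mul_of_nonneg_left hge hK0
          have h2 := mul_le_mul_of_nonneg_left hge' hK0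
          have h3 := abs_sub (φ x i) (φ y i)
          linarith [hbd x hx, hbd y hy]
    · rw [indicator_of_mem hx, indicator_of_notMem hy]
      have h1 := mul_le_mul_of_nonneg_left
        (Metric.infDist_le_dist_of_mem (x := x) (show y ∈ Dᶜ from hy)) hK0
      simp only [PiLp.zero_apply, sub_zero]
      linarith [hbd x hx]
  · rw [indicator_of_notMem hx]
    by_cases hy : y ∈ D
    · rw [indicator_of_mem hy]
      have h1 := mul_le_mul_of_nonneg_left
        (Metric.infDist_le_dist_of_mem (x := y) (show x ∈ Dᶜ from hx)) hK0
      rw [dist_comm] at h1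
      simp only [PiLp.zero_apply, zero_sub, abs_neg]
      linarith [hbd y hy]
    · rw [indicator_of_notMem hy]
      simp only [PiLp.zero_apply, sub_self, abs_zero]
      linarith

/-- The fundamental lemma of the calculus of variations, applied to each entry of the difference. -/
lemma HasWeakGradient.ae_eq {D : Set (Eucl N)} (hD : IsOpen D) (hb : Bornology.IsBounded D)
    {φ : Eucl N → Eucl m} {G G' : Eucl N → Mat m N} (hG : HasWeakGradient D φ G)
    (hG' : HasWeakGradient D φ G') (h : ∀ i j, MemLp (fun x => G x i j) ⊤ (volume.restrict D))
    (h' : ∀ i j, MemLp (fun x => G' x i j) ⊤ (volume.restrict D)) :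
    ∀ᵐ x ∂volume.restrict D, G x = G' x := by
  have : IsFiniteMeasure (volume.restrict D) := ⟨by
    rw [Measure.restrict_apply_univ]; exact hb.measure_lt_top⟩
  have key : ∀ i j, ∀ᵐ x ∂volume.restrict D, G x i j - G' x i j = 0 := by
    intro i j
    have hi : IntegrableOn (fun x => G x i j) D := (h i j).integrable le_top
    have hi' : IntegrableOn (fun x => G' x i j) D := (h' i j).integrable le_top
    rw [ae_restrict_iff' hD.measurableSet]
    refine hD.ae_eq_zero_of_integral_contDiff_smul_eq_zero (hi.sub hi').locallyIntegrableOn ?_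
    intro ζ hζ hc hs
    have hz : ∀ x ∉ D, ζ x = 0 := fun x hx => image_eq_zero_of_notMem_tsupport fun h => hx (hs h)
    rw [← setIntegral_eq_integral_of_forall_compl_eq_zero (s := D)
      (fun x hx => by simp [hz x hx])]
    obtain ⟨C, hC⟩ := hc.exists_bound_of_continuous hζ.continuous
    have e1 : Integrable (fun x => G x i j * ζ x) (volume.restrict D) :=
      hi.mul_bdd (c := C) hζ.continuous.aestronglyMeasurable (Eventually.of_forall hC)
    have e2 : Integrable (fun x => G' x i j * ζ x) (volume.restrict D) :=
      hi'.mul_bdd (c := C) hζ.continuous.aestronglyMeasurable (Eventually.of_forall hC)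
    have e3 := (hG ζ hζ hc hs i j).symm.trans (hG' ζ hζ hc hs i j)
    rw [neg_inj] at e3
    calc ∫ x in D, ζ x • (G x i j - G' x i j) =
        ∫ x in D, (G x i j * ζ x - G' x i j * ζ x) := by
          refine integral_congr_ae (Eventually.of_forall fun x => ?_)
          simp only [smul_eq_mul]; ring
      _ = 0 := by rw [integral_sub e1 e2, e3, sub_self]
  have := ae_all_iff.2 fun i => ae_all_iff.2 fun j => key i j
  filter_upwards [this] with x hx
  ext i j
  exact sub_eq_zero.1 (hx i j)

lemma HasWeakGradient.congr {D : Set (Eucl N)} (hD : IsOpen D) {φ φ' : Eucl N → Eucl m}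
    {G : Eucl N → Mat m N} (hG : HasWeakGradient D φ G) (h : ∀ x ∈ D, φ x = φ' x) :
    HasWeakGradient D φ' G := by
  intro ζ hζ hc hs i j
  rw [← hG ζ hζ hc hs i j]
  refine setIntegral_congr_fun hD.measurableSet fun x hx => ?_
  simp only [h x hx]

lemma IsW1InftyZero.exists_isTest {D : Set (Eucl N)} (hD : IsOpen D)
    (hb : Bornology.IsBounded D) (hne : Dᶜ.Nonempty) {φ : Eucl N → Eucl m} {G : Eucl N → Mat m N}
    (h : IsW1InftyZero D φ G) :
    ∃ φ' : Eucl N → Eucl m, IsTest False D φ' ∧ ∀ᵐ x ∂volume.restrict D, G x = gradMat φ' x := by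
  obtain ⟨L, hL⟩ := lipschitzWith_indicator hD hb hne h
  have ht : IsTest False D (D.indicator φ) :=
    ⟨⟨L, hL⟩, fun x hx => indicator_of_notMem hx _, False.elim⟩
  refine ⟨D.indicator φ, ht, ?_⟩
  refine (h.weakGradient.congr hD fun x hx => (indicator_of_mem hx φ).symm).ae_eq hD hb
    (hasWeakGradient_gradMat hL D) h.memLp_grad (ht.isW1InftyZero hD hb).memLp_grad

end WeakGradient

/-! ### Extension of Lipschitz data with gradients in a finite set. -/

section FillIn

variable {m N : ℕ}

/-- Whitney-type net: `V` is exhausted by compact layers where the distance to `Vᶜ` is between `1 /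
(n + 1)` and `1 / n`, and each layer gets a finite net of mesh `c / (n + 1)`. A ball staying away
from `Vᶜ` meets only finitely many layers. -/
lemma exists_locallyFinite_net {V : Set (Eucl N)} (hb : Bornology.IsBounded V) (hV : IsOpen V)
    (hne : Vᶜ.Nonempty) {c : ℝ} (hc : 0 < c) :
    ∃ Z ⊆ V, Z.Countable ∧ (∀ x ∈ V, ∃ z ∈ Z, dist x z ≤ c * Metric.infDist x Vᶜ) ∧
      ∀ x, ∀ r < Metric.infDist x Vᶜ, (Z ∩ Metric.closedBall x r).Finite := by
  set d : Eucl N → ℝ := fun x => Metric.infDist x Vᶜ with hd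
  have hdc : Continuous d := Metric.continuous_infDist_pt _
  have hpos : ∀ x ∈ V, 0 < d x := fun x hx =>
    (hV.isClosed_compl.notMem_iff_infDist_pos hne).1 (by simpa using hx)
  have hmem : ∀ x, 0 < d x → x ∈ V := fun x hx => by
    simpa using (hV.isClosed_compl.notMem_iff_infDist_pos hne).2 hx
  let K : ℕ → Set (Eucl N) := fun n => {x | n * d x ≤ 1 ∧ 1 ≤ (n + 1) * d x}
  have hKV : ∀ n, K n ⊆ V := by
    rintro n x ⟨-, hx⟩
    apply hmem
    by_contra h
    have : (n + 1 : ℝ) * d x ≤ 0 := mul_nonpos_of_nonneg_of_nonpos (by positivity) (not_lt.1 h)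
    linarith
  have hKc : ∀ n, IsCompact (K n) := by
    intro n
    refine Metric.isCompact_of_isClosed_isBounded ?_ (hb.subset (hKV n))
    exact (isClosed_le (continuous_const.mul hdc) continuous_const).inter
      (isClosed_le continuous_const (continuous_const.mul hdc))
  have hnet : ∀ n : ℕ, ∃ t ⊆ K n, t.Finite ∧ K n ⊆ ⋃ x ∈ t, Metric.ball x (c / (n + 1)) :=
    fun n => (hKc n).finite_cover_balls (by positivity)
  choose t htK htf htc using hnet
  refine ⟨⋃ n, t n, iUnion_subset fun n => (htK n).trans (hKV n),
    countable_iUnion fun n => (htf n).countable, ?_, ?_⟩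
  · intro x hx
    have hx0 := hpos x hx
    set n := ⌊1 / d x⌋₊ with hn
    have h1 : (n : ℝ) ≤ 1 / d x := Nat.floor_le (by positivity)
    have h2 : 1 / d x < n + 1 := Nat.lt_floor_add_one _
    have h3 : x ∈ K n := ⟨by rwa [le_div_iff₀ hx0] at h1, by rw [div_lt_iff₀ hx0] at h2; exact h2.le⟩
    obtain ⟨z, hz, hxz⟩ := mem_iUnion₂.1 (htc n h3)
    refine ⟨z, mem_iUnion.2 ⟨n, hz⟩, (Metric.mem_ball.1 hxz).le.trans ?_⟩
    rw [div_le_iff₀ (by positivity)]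
    have := h3.2
    calc c = c * 1 := (mul_one c).symm
      _ ≤ c * ((n + 1) * d x) := by gcongr
      _ = c * d x * (n + 1) := by ring
  · intro x r hr
    have hr' : 0 < d x - r := sub_pos.2 hr
    refine Set.Finite.subset (s := ⋃ n ∈ Finset.range (⌊1 / (d x - r)⌋₊ + 1), t n)
      (Set.Finite.biUnion (Finset.finite_toSet _) fun n _ => htf n) ?_
    rintro z ⟨hz, hzr⟩
    obtain ⟨n, hn⟩ := mem_iUnion.1 hz
    refine mem_iUnion₂.2 ⟨n, ?_, hn⟩
    rw [Finset.mem_range, Nat.lt_succ_iff]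
    apply Nat.le_floor
    have h1 := (htK n hn).1
    have h2 : d x ≤ d z + dist x z := Metric.infDist_le_infDist_add_dist
    rw [Metric.mem_closedBall, dist_comm] at hzr
    rw [le_div_iff₀ hr']
    refine le_trans ?_ h1
    gcongr
    linarith

lemma volume_hyperplane {a : Fin N → ℝ} (ha : a ≠ 0) (b : ℝ) :
    volume {y : Eucl N | ∑ j, a j * y j = b} = 0 := by
  rcases Set.eq_empty_or_nonempty {y : Eucl N | ∑ j, a j * y j = b} with h | ⟨x₀, hx₀⟩
  · rw [h, measure_empty]
  let ℓ : Eucl N →ₗ[ℝ] ℝ := ∑ j, a j • (EuclideanSpace.proj j : Eucl N →L[ℝ] ℝ).toLinearMap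
  have hℓ : ∀ y, ℓ y = ∑ j, a j * y j := by intro y; simp [ℓ]
  have htop : LinearMap.ker ℓ ≠ ⊤ := by
    intro h
    apply ha
    ext j
    have h1 : EuclideanSpace.single j (1 : ℝ) ∈ LinearMap.ker ℓ := h ▸ Submodule.mem_top
    rw [LinearMap.mem_ker, hℓ] at h1
    simpa [Pi.single_apply] using h1
  have h0 := Measure.addHaar_submodule (volume : Measure (Eucl N)) (LinearMap.ker ℓ) htop
  rw [← measure_preimage_add_right volume (-x₀)] at h0
  refine measure_mono_null (fun y hy => ?_) h0
  have hy' : ∑ j, a j * y j = b := hy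
  have hx' : ∑ j, a j * x₀ j = b := hx₀
  simp only [mem_preimage, SetLike.mem_coe, LinearMap.mem_ker, map_add, map_neg]
  rw [hℓ, hℓ, hy', hx']
  ring

lemma norm_le_sum_abs (x : Eucl N) : ‖x‖ ≤ ∑ j, |x j| := by
  rw [EuclideanSpace.norm_eq]
  refine Real.sqrt_le_iff.2 ⟨Finset.sum_nonneg fun j _ => abs_nonneg _, ?_⟩
  simpa using Finset.sum_sq_le_sq_sum_of_nonneg (s := Finset.univ)
    (f := fun j => |x j|) (fun j _ => abs_nonneg _)

lemma sum_abs_le_norm (x : Eucl N) : ∑ j, |x j| ≤ N * ‖x‖ := by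
  calc ∑ j, |x j| ≤ ∑ _j : Fin N, ‖x‖ := Finset.sum_le_sum fun j _ => norm_euclidean_coord_le x j
    _ = N * ‖x‖ := by simp

/-- A continuous function which locally takes its values among finitely many affine functions
agrees with one of them near any point where no two of them with different slopes meet. -/
lemma eventually_eq_affine {ι : Type*} {F : Set ι} (hF : F.Finite) {v : Eucl N → ℝ}
    {x : Eucl N} (hv : ContinuousAt v x) {s : ι → Fin N → ℝ} {c : ι → ℝ}
    (hloc : ∀ᶠ y in 𝓝 x, ∃ i ∈ F, v y = c i + ∑ j, s i j * y j)
    (hx : ∀ i ∈ F, ∀ k ∈ F, s i ≠ s k →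
      c i + ∑ j, s i j * x j ≠ c k + ∑ j, s k j * x j) :
    ∃ i ∈ F, ∀ᶠ y in 𝓝 x, v y = v x + ∑ j, s i j * (y j - x j) := by
  obtain ⟨i, hi, hix⟩ := hloc.self_of_nhds
  refine ⟨i, hi, ?_⟩
  have hall : ∀ k ∈ F, ∀ᶠ y in 𝓝 x, v y = c k + ∑ j, s k j * y j →
      v y = v x + ∑ j, s i j * (y j - x j) := by
    intro k hk
    have hexp : ∀ y : Eucl N, ∑ j, s i j * (y j - x j) =
        ∑ j, s i j * y j - ∑ j, s i j * x j := by
      intro y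
      rw [← Finset.sum_sub_distrib]
      exact Finset.sum_congr rfl fun j _ => by ring
    by_cases hkx : v x = c k + ∑ j, s k j * x j
    · refine Eventually.of_forall fun y hy => ?_
      have hs : s i = s k := by
        by_contra hne
        exact hx i hi k hk hne (hix.symm.trans hkx)
      rw [hexp, hy, hkx, hs]
      ring
    · have hc : ContinuousAt (fun y : Eucl N => c k + ∑ j, s k j * y j) x := by fun_prop
      filter_upwards [(hv.sub hc).eventually_ne (sub_ne_zero.2 hkx)] with y hy hy'
      exact absurd (sub_eq_zero.2 hy') hy
  filter_upwards [hloc, (eventually_all_finite hF).2 hall] with y hy hy'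
  obtain ⟨k, hk, hky⟩ := hy
  exact hy' k hk hky

/-- A Lipschitz function can be modified inside a bounded open set so that its gradient takes
finitely many prescribed values there. -/
lemma exists_fill_scalar {V : Set (Eucl N)} (hb : Bornology.IsBounded V) (hV : IsOpen V)
    (hne : Vᶜ.Nonempty) {φ : Eucl N → ℝ} {L : ℝ≥0} (hL : 0 < L) (hφ : LipschitzWith L φ) :
    ∃ v : Eucl N → ℝ, (∃ K, LipschitzWith K v) ∧ (∀ x ∉ V, v x = φ x) ∧
      ∀ᵐ x ∂volume.restrict V, ∃ s : Fin N → ℝ, (∀ j, s j = 2 * L ∨ s j = -(2 * L)) ∧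
        ∀ᶠ y in 𝓝 x, v y = v x + ∑ j, s j * (y j - x j) := by
  classical
  set d : Eucl N → ℝ := fun x => Metric.infDist x Vᶜ with hd
  have hpos : ∀ x ∈ V, 0 < d x := fun x hx =>
    (hV.isClosed_compl.notMem_iff_infDist_pos hne).1 (by simpa using hx)
  have hL' : (0 : ℝ) < L := hL
  -- By `hup`, a net point within `c * d y` of `y` has a cone at most `L * (d y / 4)` above `φ y`.
  set c : ℝ := 1 / (4 * (1 + 2 * N)) with hcdef
  have hc : 0 < c := by positivity
  have hc4 : (1 + 2 * N) * c = 1 / 4 := by rw [hcdef]; field_simp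
  have hc4' : c ≤ 1 / 4 := by
    rw [← hc4]
    have : (0 : ℝ) ≤ N := Nat.cast_nonneg N
    nlinarith
  obtain ⟨Z, hZV, hZc, hZd, hZf⟩ := exists_locallyFinite_net hb hV hne hc
  -- Cones in the `ℓ¹` norm are affine on each orthant about `z`, with slopes `± 2L`. Being steeper
  -- than `φ`, they stay above it by at least `L * dist y z`, so distant vertices cannot attain the
  -- minimum.
  let f : Eucl N → Eucl N → ℝ := fun z y => φ z + 2 * L * ∑ j, |y j - z j|
  have hlow : ∀ z y, φ y + L * dist y z ≤ f z y := by
    intro z y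
    have h1 := hφ.dist_le_mul y z
    rw [Real.dist_eq] at h1
    have h2 := le_abs_self (φ y - φ z)
    have h3 := norm_le_sum_abs (y - z)
    rw [← dist_eq_norm] at h3
    simp only [PiLp.sub_apply] at h3
    simp only [f]
    nlinarith
  have hup : ∀ z y, f z y ≤ φ y + L * ((1 + 2 * N) * dist y z) := by
    intro z y
    have h1 := hφ.dist_le_mul y z
    rw [Real.dist_eq] at h1
    have h2 := neg_abs_le (φ y - φ z)
    have h3 := sum_abs_le_norm (y - z)
    rw [← dist_eq_norm] at h3
    simp only [PiLp.sub_apply] at h3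
    simp only [f]
    nlinarith
  have hfl : ∀ z x y, f z x - f z y ≤ 2 * L * N * dist x y := by
    intro z x y
    have h3 := sum_abs_le_norm (x - y)
    rw [← dist_eq_norm] at h3
    have h4 : ∑ j, |x j - z j| ≤ ∑ j, |y j - z j| + ∑ j, |(x - y) j| := by
      rw [← Finset.sum_add_distrib]
      refine Finset.sum_le_sum fun j _ => ?_
      have := abs_add_le (y j - z j) ((x - y) j)
      refine le_trans (le_of_eq ?_) this
      congr 1
      simp
    simp only [f]
    nlinarith
  -- For these `y`, `d y ≤ 5/4 * d x`, so a vertex outside the ball of radius `3/4 * d x` is farther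
  -- than `d y / 4` from `y` and loses to the nearby net point. Hence near `x` only finitely many
  -- cones compete.
  have hatt : ∀ x ∈ V, ∀ y ∈ V, dist y x < d x / 4 →
      ∃ z ∈ Z ∩ Metric.closedBall x (3 / 4 * d x), (∀ z' ∈ Z, f z y ≤ f z' y) ∧
        f z y ≤ φ y + L * (d y / 4) := by
    intro x hx y hy hxy
    have hdx := hpos x hx
    have hdy := hpos y hy
    have hdd : d y ≤ d x + dist y x := Metric.infDist_le_infDist_add_dist
    obtain ⟨z₁, hz₁, hz₁d⟩ := hZd y hy
    have hz₁f : f z₁ y ≤ φ y + L * (d y / 4) := by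
      refine (hup z₁ y).trans ?_
      have h1 : (1 + 2 * N) * dist y z₁ ≤ (1 + 2 * N) * (c * d y) := by gcongr
      have h2 : (1 + 2 * N) * (c * d y) = d y / 4 := by rw [← mul_assoc, hc4]; ring
      rw [h2] at h1
      gcongr
    have hfin := hZf x (3 / 4 * d x) (by change 3 / 4 * d x < d x; linarith)
    have hz₁m : z₁ ∈ Z ∩ Metric.closedBall x (3 / 4 * d x) := by
      refine ⟨hz₁, ?_⟩
      rw [Metric.mem_closedBall]
      have h1 := dist_triangle z₁ y x
      rw [dist_comm z₁ y] at h1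
      have h2 : c * d y ≤ 1 / 4 * d y := by gcongr
      have h3 : dist y z₁ ≤ c * d y := hz₁d
      linarith
    obtain ⟨z₀, hz₀, hmin⟩ := hfin.exists_minimalFor (fun z => f z y) _ ⟨z₁, hz₁m⟩
    have hmin' : ∀ z ∈ Z ∩ Metric.closedBall x (3 / 4 * d x), f z₀ y ≤ f z y := by
      intro z hz
      rcases le_total (f z₀ y) (f z y) with h | h
      · exact h
      · exact hmin hz h
    refine ⟨z₀, hz₀, fun z hz => ?_, (hmin' z₁ hz₁m).trans hz₁f⟩
    by_cases hzm : z ∈ Metric.closedBall x (3 / 4 * d x)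
    · exact hmin' z ⟨hz, hzm⟩
    · rw [Metric.mem_closedBall, not_le] at hzm
      refine (hmin' z₁ hz₁m).trans (hz₁f.trans (le_trans ?_ (hlow z y)))
      have h1 := dist_triangle z y x
      rw [dist_comm z y] at h1
      have : d y / 4 ≤ dist y z := by linarith
      gcongr
  let v : Eucl N → ℝ := fun x => if x ∈ V then ⨅ z : Z, f z x else φ x
  have hvout : ∀ x ∉ V, v x = φ x := fun x hx => if_neg hx
  have hvmin : ∀ y ∈ V, ∀ z ∈ Z, (∀ z' ∈ Z, f z y ≤ f z' y) → v y = f z y := by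
    intro y hy z hz hmin
    simp only [v, if_pos hy]
    have : Nonempty Z := ⟨⟨z, hz⟩⟩
    refine le_antisymm ?_ (le_ciInf fun z' => hmin z' z'.2)
    exact ciInf_le ⟨f z y, by rintro _ ⟨z', rfl⟩; exact hmin z' z'.2⟩ (⟨z, hz⟩ : Z)
  have hvatt : ∀ y ∈ V, ∃ z ∈ Z, v y = f z y ∧ (∀ z' ∈ Z, f z y ≤ f z' y) ∧
      v y ≤ φ y + L * (d y / 4) := by
    intro y hy
    have hdy := hpos y hy
    obtain ⟨z, hz, hmin, hle⟩ := hatt y hy y hy (by rw [dist_self]; linarith)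
    have := hvmin y hy z hz.1 hmin
    exact ⟨z, hz.1, this, hmin, this ▸ hle⟩
  -- This decay towards `Vᶜ` makes `v` Lipschitz across the boundary.
  have hvφ : ∀ y ∈ V, |v y - φ y| ≤ L * (d y / 4) := by
    intro y hy
    obtain ⟨z, -, hz, -, hle⟩ := hvatt y hy
    have h1 := hlow z y
    rw [← hz] at h1
    have h2 : 0 ≤ L * dist y z := by positivity
    rw [abs_of_nonneg (by linarith)]
    linarith
  have hone : ∀ x ∈ V, ∀ y ∈ V, v x - v y ≤ 2 * L * N * dist x y := by
    intro x hx y hy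
    obtain ⟨z, hz, hvz, -, -⟩ := hvatt y hy
    obtain ⟨z', -, hvz', hmin', -⟩ := hvatt x hx
    rw [hvz, hvz']
    linarith [hmin' z hz, hfl z x y]
  have hcross : ∀ x ∈ V, ∀ y ∉ V, |v x - v y| ≤ 2 * L * dist x y := by
    intro x hx y hy
    rw [hvout y hy]
    have h1 : d x ≤ dist x y := Metric.infDist_le_dist_of_mem (show y ∈ Vᶜ from hy)
    have h2 := hφ.dist_le_mul x y
    rw [Real.dist_eq] at h2
    have h3 := abs_sub_le (v x) (φ x) (φ y)
    have h4 := hvφ x hx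
    have h5 : L * (d x / 4) ≤ L * dist x y := by
      have := hpos x hx
      gcongr
      linarith
    linarith
  have hlip : LipschitzWith (2 * L * N + 2 * L) v := by
    refine LipschitzWith.of_dist_le_mul fun x y => ?_
    push_cast
    rw [Real.dist_eq]
    have e1 : 0 ≤ 2 * L * N * dist x y := by positivity
    have e2 : 0 ≤ 2 * L * dist x y := by positivity
    rw [add_mul]
    by_cases hx : x ∈ V
    · by_cases hy : y ∈ V
      · have h1 := hone x hx y hy
        have h2 := hone y hy x hx
        rw [dist_comm] at h2
        rw [abs_le]
        constructor <;> linarith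
      · linarith [hcross x hx y hy]
    · by_cases hy : y ∈ V
      · have := hcross y hy x hx
        rw [abs_sub_comm, dist_comm] at this
        linarith
      · rw [hvout x hx, hvout y hy]
        have := hφ.dist_le_mul x y
        rw [Real.dist_eq] at this
        have e3 : 0 ≤ L * dist x y := by positivity
        linarith
  refine ⟨v, ⟨_, hlip⟩, hvout, ?_⟩
  let Sg : Set (Fin N → ℝ) := {s | ∀ j, s j = 2 * L ∨ s j = -(2 * L)}
  have hSg : Sg.Finite := by
    have : (Set.pi univ fun _ : Fin N => ({2 * (L : ℝ), -(2 * (L : ℝ))} : Set ℝ)).Finite :=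
      Set.Finite.pi fun _ => Set.toFinite _
    refine this.subset fun s hs j _ => ?_
    simpa using hs j
  let cst : Eucl N × (Fin N → ℝ) → ℝ := fun q => φ q.1 - ∑ j, q.2 j * q.1 j
  have hfg : ∀ z y, ∃ s ∈ Sg, f z y = cst (z, s) + ∑ j, s j * y j := by
    intro z y
    refine ⟨fun j => if 0 ≤ y j - z j then 2 * (L : ℝ) else -(2 * (L : ℝ)), ?_, ?_⟩
    · intro j
      by_cases h : 0 ≤ y j - z j <;> simp [h]
    · simp only [f, cst]
      rw [Finset.mul_sum, sub_add_eq_add_sub, add_sub_assoc, ← Finset.sum_sub_distrib]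
      congr 1
      refine Finset.sum_congr rfl fun j _ => ?_
      by_cases h : 0 ≤ y j - z j
      · rw [if_pos h, abs_of_nonneg h]; ring
      · rw [if_neg h, abs_of_neg (not_le.1 h)]; ring
  let I : Set (Eucl N × (Fin N → ℝ)) := Z ×ˢ Sg
  have hIc : I.Countable := hZc.prod hSg.countable
  -- Two affine functions with different slopes agree only on a hyperplane or nowhere, and there are
  -- countably many pairs.
  have hnull : ∀ᵐ x : Eucl N, ∀ i ∈ I, ∀ k ∈ I, i.2 ≠ k.2 →
      cst i + ∑ j, i.2 j * x j ≠ cst k + ∑ j, k.2 j * x j := by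
    rw [ae_ball_iff hIc]
    intro i _
    rw [ae_ball_iff hIc]
    intro k _
    by_cases hik : i.2 = k.2
    · exact Eventually.of_forall fun x h => absurd hik h
    have h0 := volume_hyperplane (sub_ne_zero.2 hik) (cst k - cst i)
    rw [← compl_mem_ae_iff] at h0
    filter_upwards [h0] with x hx _ heq
    apply hx
    change ∑ j, (i.2 - k.2) j * x j = cst k - cst i
    have : ∑ j, (i.2 - k.2) j * x j = ∑ j, i.2 j * x j - ∑ j, k.2 j * x j := by
      rw [← Finset.sum_sub_distrib]
      exact Finset.sum_congr rfl fun j _ => by simp; ring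
    linarith
  filter_upwards [ae_restrict_mem hV.measurableSet, ae_restrict_of_ae hnull] with x hx hxn
  have hdx := hpos x hx
  have hFf : ((Z ∩ Metric.closedBall x (3 / 4 * d x)) ×ˢ Sg).Finite :=
    (hZf x _ (by change 3 / 4 * d x < d x; linarith)).prod hSg
  have hloc : ∀ᶠ y in 𝓝 x, ∃ i ∈ (Z ∩ Metric.closedBall x (3 / 4 * d x)) ×ˢ Sg,
      v y = cst i + ∑ j, i.2 j * y j := by
    filter_upwards [hV.mem_nhds hx, Metric.ball_mem_nhds x (show 0 < d x / 4 by linarith)]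
      with y hy hyx
    obtain ⟨z, hz, hmin, -⟩ := hatt x hx y hy (Metric.mem_ball.1 hyx)
    obtain ⟨s, hs, hfs⟩ := hfg z y
    exact ⟨(z, s), ⟨hz, hs⟩, (hvmin y hy z hz.1 hmin).trans hfs⟩
  obtain ⟨i, hi, hev⟩ := eventually_eq_affine (s := fun i => i.2) (c := cst) hFf
    hlip.continuous.continuousAt hloc
    (fun i hi k hk => hxn i ⟨hi.1.1, hi.2⟩ k ⟨hk.1.1, hk.2⟩)
  exact ⟨i.2, hi.2, hev⟩

/-- The matrices all of whose entries are `± 2L`. -/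
def slopeSet (m N : ℕ) (L : ℝ≥0) : Set (Mat m N) :=
  {ξ | ∀ i j, ξ i j = 2 * L ∨ ξ i j = -(2 * L)}

lemma finite_slopeSet (L : ℝ≥0) : (slopeSet m N L).Finite := by
  have : (Set.pi univ fun _ : Fin m => Set.pi univ fun _ : Fin N =>
      ({2 * (L : ℝ), -(2 * (L : ℝ))} : Set ℝ)).Finite :=
    Set.Finite.pi fun _ => Set.Finite.pi fun _ => Set.toFinite _
  refine this.subset fun s hs i _ j _ => ?_
  simpa using hs i j

/-- Each coordinate is first extended from `Vᶜ` with the same constant (McShane) and then modified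
in `V` by `exists_fill_scalar`. Gradients of all coordinates are treated at once at almost every
point. -/
lemma exists_fill {V : Set (Eucl N)} (hb : Bornology.IsBounded V) (hV : IsOpen V)
    (hne : Vᶜ.Nonempty) {u : Eucl N → Eucl m} {L : ℝ≥0} (hL : 0 < L)
    (hu : LipschitzOnWith L u Vᶜ) :
    ∃ v : Eucl N → Eucl m, (∃ K, LipschitzWith K v) ∧ (∀ x ∉ V, v x = u x) ∧
      ∀ᵐ x ∂volume.restrict V, ∃ ξ ∈ slopeSet m N L,
        v =ᶠ[𝓝 x] fun y => v x + matCLM ξ (y - x) := by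
  have h1 : ∀ i, ∃ w : Eucl N → ℝ, (∃ K, LipschitzWith K w) ∧ (∀ x ∉ V, w x = u x i) ∧
      ∀ᵐ x ∂volume.restrict V, ∃ s : Fin N → ℝ, (∀ j, s j = 2 * L ∨ s j = -(2 * L)) ∧
        ∀ᶠ y in 𝓝 x, w y = w x + ∑ j, s j * (y j - x j) := by
    intro i
    have h2 : LipschitzOnWith L (fun x => u x i) Vᶜ := by
      refine LipschitzOnWith.of_dist_le_mul fun x hx y hy => ?_
      refine le_trans ?_ (hu.dist_le_mul x hx y hy)
      rw [Real.dist_eq, dist_eq_norm]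
      exact norm_euclidean_coord_le (u x - u y) i
    obtain ⟨φ, hφ, hφu⟩ := h2.extend_real
    obtain ⟨w, hK, hw, hae⟩ := exists_fill_scalar hb hV hne hL hφ
    exact ⟨w, hK, fun x hx => (hw x hx).trans (hφu hx).symm, hae⟩
  choose w hK hw hae using h1
  choose K hK using hK
  refine ⟨fun x => WithLp.toLp 2 fun i => w i x, ⟨_, LipschitzWith.of_coord (L := ∑ i, K i)
    fun i => (hK i).weaken (Finset.single_le_sum (fun _ _ => zero_le) (Finset.mem_univ i))⟩,
    fun x hx => ?_, ?_⟩
  · ext i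
    exact hw i x hx
  · filter_upwards [ae_all_iff.2 hae] with x hx
    choose s hs hev using hx
    refine ⟨Matrix.of s, fun i j => hs i j, ?_⟩
    filter_upwards [eventually_all.2 hev] with y hy
    ext i
    simp only [PiLp.add_apply, matCLM_apply, Matrix.of_apply, PiLp.sub_apply]
    exact hy i

end FillIn

/-! ### Homothetic copies and change of domain. -/

section Rescale

variable {m N : ℕ}

/-- The inverse of the homothety `y ↦ a.1 + a.2 • y`. -/
noncomputable def pull (a : Eucl N × ℝ) (y : Eucl N) : Eucl N := a.2⁻¹ • (y - a.1)

/-- The Jacobian of the homothety `y ↦ a.1 + a.2 • y`. -/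
noncomputable def pullFactor (a : Eucl N × ℝ) : ℝ≥0∞ :=
  ENNReal.ofReal |(a.2⁻¹ ^ Module.finrank ℝ (Eucl N))⁻¹|

lemma continuous_pull (a : Eucl N × ℝ) : Continuous (pull a) := by
  unfold pull
  fun_prop

lemma map_pull {a : Eucl N × ℝ} (ha : 0 < a.2) :
    Measure.map (pull a) volume = pullFactor a • (volume : Measure (Eucl N)) := by
  have h : pull a = (fun x => a.2⁻¹ • x) ∘ fun y => y - a.1 := rfl
  rw [h, ← Measure.map_map (by fun_prop) (by fun_prop), map_sub_right_eq_self,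
    Measure.map_addHaar_smul volume (inv_ne_zero ha.ne')]
  rfl

lemma volume_preimage_pull {a : Eucl N × ℝ} (ha : 0 < a.2) {U : Set (Eucl N)}
    (hU : MeasurableSet U) : volume (pull a ⁻¹' U) = pullFactor a * volume U := by
  rw [← Measure.map_apply (continuous_pull a).measurable hU, map_pull ha]
  rfl

lemma setLIntegral_pull {a : Eucl N × ℝ} (ha : 0 < a.2) {U : Set (Eucl N)}
    (hU : MeasurableSet U) {f : Eucl N → ℝ≥0∞} (hf : Measurable f) :
    ∫⁻ y in pull a ⁻¹' U, f (pull a y) = pullFactor a * ∫⁻ x in U, f x := by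
  rw [← setLIntegral_map hU hf (continuous_pull a).measurable, map_pull ha,
    Measure.restrict_smul, lintegral_smul_measure]
  rfl

lemma preimage_pull_closedBall {a : Eucl N × ℝ} (ha : 0 < a.2) (R : ℝ) :
    pull a ⁻¹' Metric.closedBall 0 R = Metric.closedBall a.1 (a.2 * R) := by
  ext y
  simp only [mem_preimage, pull, Metric.mem_closedBall, dist_eq_norm, sub_zero, norm_smul, norm_inv, Real.norm_eq_abs,
    abs_of_pos ha]
  rw [inv_mul_le_iff₀ ha]

/-- Almost all of an open set is filled by disjoint homothetic copies of a bounded open set whose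
boundary is negligible. -/
lemma exists_disjoint_copies {U : Set (Eucl N)} (hU : IsOpen U) (hUb : Bornology.IsBounded U)
    (hne : U.Nonempty) (hfr : volume (frontier U) = 0) {V : Set (Eucl N)} (hV : IsOpen V) :
    ∃ T : Set (Eucl N × ℝ), T.Countable ∧ (∀ a ∈ T, 0 < a.2) ∧
      (T.PairwiseDisjoint fun a => pull a ⁻¹' U) ∧ (∀ a ∈ T, pull a ⁻¹' U ⊆ V) ∧
      volume (V \ ⋃ a ∈ T, pull a ⁻¹' U) = 0 := by
  obtain ⟨R, hR, hUR⟩ := hUb.subset_closedBall_lt 0 0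
  have hcl : closure U ⊆ Metric.closedBall 0 R := closure_minimal hUR Metric.isClosed_closedBall
  have hUpos : volume U ≠ 0 := (hU.measure_pos volume hne).ne'
  have hUtop : volume U ≠ ⊤ := hUb.measure_lt_top.ne
  let t : Set (Eucl N × ℝ) := {a | 0 < a.2 ∧ Metric.closedBall a.1 (a.2 * R) ⊆ V}
  have hball : ∀ a ∈ t, pull a ⁻¹' closure U ⊆ Metric.closedBall a.1 (a.2 * R) := by
    intro a ha
    rw [← preimage_pull_closedBall ha.1]
    exact preimage_mono hcl
  -- The covering theorem needs closed sets filling a fixed proportion of a ball; by scaling, that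
  -- proportion is the same for all copies of `closure U`. The null frontier later allows the return
  -- to the open copies.
  obtain ⟨T, hTt, hTc, hTd, hTn⟩ := Vitali.exists_disjoint_covering_ae volume V t
    (volume (Metric.closedBall (0 : Eucl N) (3 * R)) / volume U).toNNReal
    (fun a => a.2 * R) (fun a => a.1) (fun a => pull a ⁻¹' closure U) hball
    (by
      intro a ha
      have h1 : 3 * (a.2 * R) = a.2 * (3 * R) := by ring
      rw [h1, ← preimage_pull_closedBall ha.1,
        volume_preimage_pull ha.1 Metric.isClosed_closedBall.measurableSet,
        ENNReal.coe_toNNReal (ENNReal.div_lt_top measure_closedBall_lt_top.ne hUpos).ne]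
      have h2 : pullFactor a * volume U ≤ volume (pull a ⁻¹' closure U) := by
        rw [← volume_preimage_pull ha.1 hU.measurableSet]
        exact measure_mono (preimage_mono subset_closure)
      calc pullFactor a * volume (Metric.closedBall (0 : Eucl N) (3 * R))
          = volume (Metric.closedBall (0 : Eucl N) (3 * R)) / volume U *
            (pullFactor a * volume U) := by
            rw [mul_comm (pullFactor a) (volume U), ← mul_assoc,
              ENNReal.div_mul_cancel hUpos hUtop, mul_comm]
        _ ≤ _ := by gcongr)
    (by
      intro a ha
      obtain ⟨x, hx⟩ := hne
      refine ⟨a.1 + a.2 • x, interior_mono (preimage_mono subset_closure) ?_⟩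
      rw [(hU.preimage (continuous_pull a)).interior_eq]
      simpa [pull, smul_smul, inv_mul_cancel₀ ha.1.ne'] using hx)
    (fun a _ => isClosed_closure.preimage (continuous_pull a))
    (by
      intro x hx ε hε
      obtain ⟨r, hr, hrV⟩ := Metric.nhds_basis_closedBall.mem_iff.1 (hV.mem_nhds hx)
      refine ⟨(x, min r ε / R), ⟨div_pos (lt_min hr hε) hR, ?_⟩, ?_, rfl⟩
      · dsimp only
        rw [div_mul_cancel₀ _ hR.ne']
        exact (Metric.closedBall_subset_closedBall (min_le_left _ _)).trans hrV
      · dsimp only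
        rw [div_mul_cancel₀ _ hR.ne']
        exact min_le_right _ _)
  refine ⟨T, hTc, fun a ha => (hTt ha).1, hTd.mono fun a => preimage_mono subset_closure,
    fun a ha => (preimage_mono subset_closure).trans ((hball a (hTt ha)).trans (hTt ha).2), ?_⟩
  have hfrT : volume (⋃ a ∈ T, pull a ⁻¹' frontier U) = 0 := by
    rw [measure_biUnion_null_iff hTc]
    intro a ha
    rw [volume_preimage_pull (hTt ha).1 isClosed_frontier.measurableSet, hfr, mul_zero]
  refine measure_mono_null ?_ (measure_union_null hTn hfrT)
  rintro x ⟨hx, hx'⟩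
  by_cases h : x ∈ ⋃ a ∈ T, pull a ⁻¹' closure U
  · right
    obtain ⟨a, ha, hxa⟩ := mem_iUnion₂.1 h
    refine mem_iUnion₂.2 ⟨a, ha, ?_⟩
    rw [hU.frontier_eq]
    exact ⟨hxa, fun h2 => hx' (mem_iUnion₂.2 ⟨a, ha, h2⟩)⟩
  · exact Or.inl ⟨hx, h⟩

lemma gradMat_rescale {a : Eucl N × ℝ} (ha : 0 < a.2) (φ : Eucl N → Eucl m) (y : Eucl N) :
    gradMat (fun z => a.2 • φ (pull a z)) y = gradMat φ (pull a y) := by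
  have h1 : fderiv ℝ (fun z => a.2 • φ (pull a z)) y =
      a.2 • fderiv ℝ (fun z => φ (pull a z)) y :=
    congrFun (fderiv_const_smul_field (f := fun z => φ (pull a z)) a.2) y
  have h2 : fderiv ℝ (fun z => φ (pull a z)) y = a.2⁻¹ • fderiv ℝ φ (pull a y) := by
    have h3 := fderiv_comp_sub (𝕜 := ℝ) (f := fun w => φ (a.2⁻¹ • w)) (x := y) a.1
    have h4 := fderiv_comp_smul (𝕜 := ℝ) (f := φ) (x := y - a.1) a.2⁻¹
    exact h3.trans h4
  rw [gradMat, h1, h2, smul_smul, mul_inv_cancel₀ ha.ne', one_smul]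
  rfl

lemma preimage_pull_gradRegion {a : Eucl N × ℝ} (ha : 0 < a.2) (φ : Eucl N → Eucl m)
    (ξ : Mat m N) : pull a ⁻¹' gradRegion (gradMat φ) ξ ⊆
      gradRegion (gradMat fun z => a.2 • φ (pull a z)) ξ := by
  intro y hy
  have hO := isOpen_gradRegion (gradMat φ) ξ
  refine ⟨pull a ⁻¹' gradRegion (gradMat φ) ξ, (hO.preimage (continuous_pull a)).mem_nhds hy, ?_⟩
  have h1 := ae_gradRegion (gradMat φ) ξ
  rw [ae_restrict_iff' hO.measurableSet] at h1
  rw [ae_restrict_iff' (hO.preimage (continuous_pull a)).measurableSet]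
  have h2 : ∀ᵐ x ∂(Measure.map (pull a) volume), x ∈ gradRegion (gradMat φ) ξ →
      gradMat φ x = ξ := by
    rw [map_pull ha]
    exact Measure.ae_smul_measure h1 _
  filter_upwards [ae_of_ae_map (continuous_pull a).aemeasurable h2] with x hx hx'
  rw [gradMat_rescale ha]
  exact hx hx'

lemma lipschitzWith_rescale {a : Eucl N × ℝ} (ha : 0 < a.2) {φ : Eucl N → Eucl m} {L : ℝ≥0}
    (h : LipschitzWith L φ) : LipschitzWith L fun z => a.2 • φ (pull a z) := by
  refine LipschitzWith.of_dist_le_mul fun x y => ?_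
  rw [dist_smul₀, Real.norm_eq_abs, abs_of_pos ha]
  have h1 := h.dist_le_mul (pull a x) (pull a y)
  have h2 : dist (pull a x) (pull a y) = a.2⁻¹ * dist x y := by
    simp only [pull]
    rw [dist_smul₀, dist_sub_right, norm_inv, Real.norm_eq_abs, abs_of_pos ha]
  rw [h2] at h1
  calc a.2 * dist (φ (pull a x)) (φ (pull a y)) ≤ a.2 * (L * (a.2⁻¹ * dist x y)) := by gcongr
    _ = L * dist x y := by field_simp

/-- Test functions are transplanted from one bounded open set to another, keeping the
distribution of the gradient. -/
lemma IsTest.transplant {b : Prop} {U V : Set (Eucl N)} (hU : IsOpen U)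
    (hUb : Bornology.IsBounded U) (hne : U.Nonempty) (hfr : volume (frontier U) = 0)
    (hV : IsOpen V) {φ : Eucl N → Eucl m} (hφ : IsTest b U φ) :
    ∃ ψ : Eucl N → Eucl m, IsTest b V ψ ∧ ∀ f : Mat m N → ℝ≥0∞, Measurable f →
      volume U * ∫⁻ x in V, f (gradMat ψ x) = volume V * ∫⁻ x in U, f (gradMat φ x) := by
  obtain ⟨T, hTc, hT0, hTd, hTV, hTn⟩ := exists_disjoint_copies hU hUb hne hfr hV
  obtain ⟨L, hL⟩ := hφ.lip
  -- The rescaling `a.2 • φ (pull a z)` preserves the Lipschitz constant, so one `L` serves for all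
  -- the countably many copies.
  obtain ⟨ψ, hψL, hψ, hψ0⟩ := exists_lipschitzWith_glue (ι := T)
    (U := fun a => pull (a : Eucl N × ℝ) ⁻¹' U)
    (ψ := fun a z => (a : Eucl N × ℝ).2 • φ (pull a z)) (L := L)
    (fun a b hab => hTd a.2 b.2 fun h => hab (Subtype.ext h))
    (fun a => lipschitzWith_rescale (hT0 a a.2) hL)
    (fun a x hx => by rw [hφ.zero _ hx, smul_zero])
  have hgrad : ∀ a ∈ T, ∀ y ∈ pull a ⁻¹' U, ψ =ᶠ[𝓝 y] fun z => a.2 • φ (pull a z) := by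
    intro a ha y hy
    filter_upwards [(hU.preimage (continuous_pull a)).mem_nhds hy] with z hz
    exact hψ ⟨a, ha⟩ z hz
  refine ⟨ψ, ⟨⟨_, hψL⟩, fun x hx => hψ0 x fun a ha => hx (hTV a a.2 ha), fun hb => ?_⟩, ?_⟩
  · obtain ⟨S, hS⟩ := hφ.fin hb
    have hm : MeasurableSet (U \ ⋃ ξ ∈ S, gradRegion (gradMat φ) ξ) :=
      hU.measurableSet.diff
        (isOpen_biUnion fun ξ _ => isOpen_gradRegion _ ξ).measurableSet
    refine ⟨S, ?_⟩
    have h1 : volume (⋃ a ∈ T, pull a ⁻¹' (U \ ⋃ ξ ∈ S, gradRegion (gradMat φ) ξ)) = 0 := by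
      rw [measure_biUnion_null_iff hTc]
      intro a ha
      rw [volume_preimage_pull (hT0 a ha) hm, hS, mul_zero]
    refine measure_mono_null ?_ (measure_union_null hTn h1)
    rintro x ⟨hx, hx'⟩
    by_cases h : x ∈ ⋃ a ∈ T, pull a ⁻¹' U
    · right
      obtain ⟨a, ha, hxa⟩ := mem_iUnion₂.1 h
      refine mem_iUnion₂.2 ⟨a, ha, hxa, fun h2 => hx' ?_⟩
      obtain ⟨ξ, hξ, h3⟩ := mem_iUnion₂.1 h2
      refine mem_iUnion₂.2 ⟨ξ, hξ, ?_⟩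
      obtain ⟨O, hO, hOξ⟩ := preimage_pull_gradRegion (hT0 a ha) φ ξ h3
      have hUa := hU.preimage (continuous_pull a)
      refine ⟨O ∩ pull a ⁻¹' U, inter_mem hO (hUa.mem_nhds hxa), ?_⟩
      have h4 : ∀ᵐ y ∂volume.restrict (O ∩ pull a ⁻¹' U), y ∈ pull a ⁻¹' U :=
        ae_restrict_of_ae_restrict_of_subset inter_subset_right
          (ae_restrict_mem hUa.measurableSet)
      filter_upwards [ae_restrict_of_ae_restrict_of_subset inter_subset_left hOξ, h4] with y h5 h6
      rw [gradMat_congr (hgrad a ha y h6), h5]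
    · exact Or.inl ⟨hx, h⟩
  · intro f hf
    have hsub : (⋃ a ∈ T, pull a ⁻¹' U) ⊆ V := iUnion₂_subset hTV
    have hae : V =ᵐ[volume] (⋃ a ∈ T, pull a ⁻¹' U : Set (Eucl N)) :=
      ae_eq_set.2 ⟨hTn, by rw [sdiff_eq_empty.2 hsub, measure_empty]⟩
    have hms : ∀ a ∈ T, MeasurableSet (pull a ⁻¹' U) := fun a _ =>
      (hU.preimage (continuous_pull a)).measurableSet
    rw [setLIntegral_congr hae, measure_congr hae, lintegral_biUnion hTc hms hTd,
      measure_biUnion hTc hTd hms, ← ENNReal.tsum_mul_left, ← ENNReal.tsum_mul_right]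
    refine tsum_congr fun a => ?_
    have h1 : ∫⁻ x in pull (a : Eucl N × ℝ) ⁻¹' U, f (gradMat ψ x) =
        ∫⁻ x in pull (a : Eucl N × ℝ) ⁻¹' U, f (gradMat φ (pull a x)) := by
      refine setLIntegral_congr_fun (hms a a.2) fun x hx => ?_
      rw [gradMat_congr (hgrad a a.2 x hx), gradMat_rescale (hT0 a a.2)]
    have h2 := setLIntegral_pull (hT0 a a.2) hU.measurableSet (hf.comp (measurable_gradMat φ))
    simp only [Function.comp_apply] at h2
    rw [h1, h2, volume_preimage_pull (hT0 a a.2) hU.measurableSet]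
    ring

end Rescale

/-! ### The unit cube. -/

section UnitCube

variable {N : ℕ}

lemma isOpen_unitCube : IsOpen (unitCube N) := by
  have : unitCube N = ⋂ i, {x : Eucl N | x i ∈ Set.Ioo (0 : ℝ) 1} := by
    ext x; simp [unitCube]
  rw [this]
  exact isOpen_iInter_of_finite fun i =>
    isOpen_Ioo.preimage (EuclideanSpace.proj i : Eucl N →L[ℝ] ℝ).continuous

lemma isBounded_unitCube : Bornology.IsBounded (unitCube N) := by
  refine (Metric.isBounded_iff_subset_closedBall 0).2 ⟨N, fun x hx => ?_⟩
  rw [mem_closedBall_zero_iff]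
  refine (norm_le_sum_abs x).trans ?_
  calc ∑ j, |x j| ≤ ∑ _j : Fin N, (1 : ℝ) := by
        refine Finset.sum_le_sum fun j _ => ?_
        rw [abs_of_pos (hx j).1]
        exact (hx j).2.le
    _ = N := by simp

lemma convex_unitCube : Convex ℝ (unitCube N) := by
  have : unitCube N = ⋂ i, {x : Eucl N | x i ∈ Set.Ioo (0 : ℝ) 1} := by
    ext x; simp [unitCube]
  rw [this]
  exact convex_iInter fun i => (convex_Ioo (0 : ℝ) 1).linear_preimage
    (EuclideanSpace.proj i : Eucl N →L[ℝ] ℝ).toLinearMap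

lemma volume_unitCube : volume (unitCube N) = 1 := by
  have h : unitCube N = (MeasurableEquiv.toLp 2 (Fin N → ℝ)).symm ⁻¹'
      (Set.pi univ fun _ => Set.Ioo (0 : ℝ) 1) := by
    ext x; simp [unitCube]
  rw [h, (EuclideanSpace.volume_preserving_symm_measurableEquiv_toLp (Fin N)).measure_preimage
    (MeasurableSet.univ_pi fun _ => measurableSet_Ioo).nullMeasurableSet, volume_pi_pi]
  simp

lemma nonempty_unitCube : (unitCube N).Nonempty := by
  refine ⟨WithLp.toLp 2 fun _ => 1 / 2, fun i => ?_⟩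
  norm_num

lemma volume_frontier_unitCube : volume (frontier (unitCube N)) = 0 :=
  convex_unitCube.addHaar_frontier volume

lemma compl_nonempty_of_isBounded (hN : 0 < N) {D : Set (Eucl N)}
    (hb : Bornology.IsBounded D) : Dᶜ.Nonempty := by
  have : Nonempty (Fin N) := ⟨⟨0, hN⟩⟩
  rw [nonempty_compl]
  rintro rfl
  exact NormedSpace.unbounded_univ ℝ (Eucl N) hb

end UnitCube

/-! ### The relaxed energy and its behaviour along piecewise affine maps. -/

section RelaxedEnergy

variable {m N : ℕ}

/-- The common form of `ZInfty` (for `b = False`) and `ZAff` (for `b = True`). -/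
noncomputable def relaxed (b : Prop) (W : Mat m N → ℝ≥0∞) (F : Mat m N) : ℝ≥0∞ :=
  ⨅ (φ : Eucl N → Eucl m) (_ : IsTest b (unitCube N) φ),
    ∫⁻ y in unitCube N, W (F + gradMat φ y)

lemma ZInfty_eq_relaxed (hN : 0 < N) (W : Mat m N → ℝ≥0∞) : ZInfty W = relaxed False W := by
  ext F
  refine le_antisymm ?_ ?_
  · refine le_iInf₂ fun φ hφ => ?_
    exact iInf₂_le_of_le φ (gradMat φ)
      (iInf_le_of_le (hφ.isW1InftyZero isOpen_unitCube isBounded_unitCube) le_rfl)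
  · refine le_iInf₂ fun φ G => le_iInf fun h => ?_
    obtain ⟨φ', hφ', hae⟩ := h.exists_isTest isOpen_unitCube isBounded_unitCube
      (compl_nonempty_of_isBounded hN isBounded_unitCube)
    refine iInf₂_le_of_le φ' hφ' (lintegral_mono_ae ?_)
    filter_upwards [hae] with x hx
    rw [hx]

lemma ZAff_eq_relaxed (hN : 0 < N) (W : Mat m N → ℝ≥0∞) : ZAff W = relaxed True W := by
  ext F
  refine le_antisymm ?_ ?_
  · refine le_iInf₂ fun φ hφ => ?_
    exact iInf₂_le_of_le φ (gradMat φ) (iInf_le_of_le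
      ⟨hφ.isW1InftyZero isOpen_unitCube isBounded_unitCube,
        (hφ.fin trivial).isPiecewiseConstant isOpen_unitCube volume_frontier_unitCube⟩ le_rfl)
  · refine le_iInf₂ fun φ G => le_iInf fun h => ?_
    obtain ⟨φ', hφ', hae⟩ := h.1.exists_isTest isOpen_unitCube isBounded_unitCube
      (compl_nonempty_of_isBounded hN isBounded_unitCube)
    refine iInf₂_le_of_le φ' ⟨hφ'.lip, hφ'.zero, fun _ =>
      (FinGrad.of_isPiecewiseConstant h.2).congr isOpen_unitCube hae⟩ (lintegral_mono_ae ?_)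
    filter_upwards [hae] with x hx
    rw [hx]

lemma measurable_comp_const_add {W : Mat m N → ℝ≥0∞} (hW : Measurable W) (F : Mat m N) :
    Measurable fun G => W (F + G) :=
  hW.comp (continuous_const.add continuous_id).measurable

/-- Independence of the domain: `φ` is transplanted from `D` to the cube, which preserves the
average of the integrand. -/
lemma relaxed_mul_le {b : Prop} {W : Mat m N → ℝ≥0∞} (hW : Measurable W) {D : Set (Eucl N)}
    (hD : IsOpen D) (hb : Bornology.IsBounded D) (hfr : volume (frontier D) = 0) (F : Mat m N)
    {φ : Eucl N → Eucl m} (hφ : IsTest b D φ) :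
    relaxed b W F * volume D ≤ ∫⁻ x in D, W (F + gradMat φ x) := by
  rcases D.eq_empty_or_nonempty with rfl | hne
  · simp
  obtain ⟨ψ, hψ, hint⟩ := hφ.transplant hD hb hne hfr isOpen_unitCube
  have h := hint _ (measurable_comp_const_add hW F)
  rw [volume_unitCube, one_mul] at h
  rw [← h, mul_comm]
  gcongr
  exact iInf₂_le ψ hψ

/-- Finiteness yields a nearly optimal map on the cube, which is transplanted to `D`. -/
lemma exists_isTest_lintegral_le {b : Prop} {W : Mat m N → ℝ≥0∞} (hW : Measurable W)
    {D : Set (Eucl N)} (hD : IsOpen D) {ξ : Mat m N} (hξ : relaxed b W ξ ≠ ⊤) {ε : ℝ≥0∞}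
    (hε : ε ≠ 0) : ∃ ψ : Eucl N → Eucl m, IsTest b D ψ ∧
      ∫⁻ x in D, W (ξ + gradMat ψ x) ≤ (relaxed b W ξ + ε) * volume D := by
  have h := ENNReal.lt_add_right hξ hε
  conv_lhs at h => rw [relaxed]
  simp only [iInf_lt_iff] at h
  obtain ⟨φ, hφ, hlt⟩ := h
  obtain ⟨ψ, hψ, hint⟩ := hφ.transplant isOpen_unitCube isBounded_unitCube nonempty_unitCube
    volume_frontier_unitCube hD
  refine ⟨ψ, hψ, ?_⟩
  have h := hint _ (measurable_comp_const_add hW ξ)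
  rw [volume_unitCube, one_mul] at h
  rw [h, mul_comm]
  gcongr

/-- On each region where the gradient of a piecewise affine function is constant, an almost
optimal test function may be inserted. -/
lemma exists_isTest_refine {b : Prop} {W : Mat m N → ℝ≥0∞} (hW : Measurable W)
    (hfin : ∀ F, relaxed b W F ≠ ⊤) {D : Set (Eucl N)} (hD : IsOpen D) (F : Mat m N)
    {φ : Eucl N → Eucl m} (hφ : IsTest True D φ) {ε : ℝ≥0∞} (hε : ε ≠ 0) :
    ∃ χ : Eucl N → Eucl m, IsTest b D χ ∧ ∫⁻ x in D, W (F + gradMat χ x) ≤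
      ∫⁻ x in D, (relaxed b W (F + gradMat φ x) + ε) := by
  classical
  obtain ⟨S, hS⟩ := hφ.fin trivial
  obtain ⟨Lφ, hLφ⟩ := hφ.lip
  let R : Mat m N → Set (Eucl N) := fun ξ => D ∩ gradRegion (gradMat φ) ξ
  have hRo : ∀ ξ, IsOpen (R ξ) := fun ξ => hD.inter (isOpen_gradRegion _ ξ)
  have hex := fun ξ => exists_isTest_lintegral_le (b := b) hW (hRo ξ) (hfin (F + ξ)) hε
  choose ψ hψ hψle using hex
  choose L hL using fun ξ => (hψ ξ).lip
  obtain ⟨Ψ, hΨL, hΨ, hΨ0⟩ := exists_lipschitzWith_glue (ι := S) (U := fun ξ => R ξ)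
    (ψ := fun ξ => ψ ξ) (L := ∑ ξ : S, L ξ)
    (fun ξ η h => (disjoint_gradRegion _ fun h' => h (Subtype.ext h')).mono
      inter_subset_right inter_subset_right)
    (fun ξ => (hL ξ).weaken (Finset.single_le_sum (f := fun ξ : S => L ξ)
      (fun _ _ => zero_le) (Finset.mem_univ ξ)))
    (fun ξ => (hψ ξ).zero)
  have hgrad : ∀ ξ ∈ S, ∀ᵐ x ∂volume.restrict (R ξ),
      gradMat (fun y => φ y + Ψ y) x = ξ + gradMat (ψ ξ) x := by
    intro ξ hξ
    filter_upwards [ae_restrict_of_ae hLφ.ae_differentiableAt,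
      ae_restrict_of_ae hΨL.ae_differentiableAt, ae_restrict_mem (hRo ξ).measurableSet,
      ae_restrict_of_ae_restrict_of_subset inter_subset_right (ae_gradRegion (gradMat φ) ξ)]
      with x h1 h2 h3 h4
    rw [gradMat_add h1 h2, h4]
    congr 1
    apply gradMat_congr
    filter_upwards [(hRo ξ).mem_nhds h3] with y hy
    exact hΨ ⟨ξ, hξ⟩ y hy
  refine ⟨fun y => φ y + Ψ y, ⟨⟨_, hLφ.add hΨL⟩, fun x hx => ?_, fun hb => ?_⟩, ?_⟩
  · rw [hφ.zero x hx, hΨ0 x fun ξ hξ => hx hξ.1, add_zero]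
  · choose T hT using fun ξ => (hψ ξ).fin hb
    refine ⟨S.biUnion fun ξ => (T ξ).image fun η => ξ + η, ?_⟩
    have h1 : volume (⋃ ξ ∈ S, (R ξ \ ⋃ η ∈ T ξ, gradRegion (gradMat (ψ ξ)) η)) = 0 :=
      (measure_biUnion_null_iff S.countable_toSet).2 fun ξ _ => hT ξ
    refine measure_mono_null ?_ (measure_union_null hS h1)
    rintro x ⟨hx, hx'⟩
    by_cases h : x ∈ ⋃ ξ ∈ S, gradRegion (gradMat φ) ξ
    · right
      obtain ⟨ξ, hξ, hxξ⟩ := mem_iUnion₂.1 h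
      refine mem_iUnion₂.2 ⟨ξ, hξ, ⟨hx, hxξ⟩, fun h2 => hx' ?_⟩
      obtain ⟨η, hη, U, hU, hUη⟩ := mem_iUnion₂.1 h2
      refine mem_iUnion₂.2 ⟨ξ + η, Finset.mem_biUnion.2 ⟨ξ, hξ, Finset.mem_image_of_mem _ hη⟩,
        U ∩ R ξ, inter_mem hU ((hRo ξ).mem_nhds ⟨hx, hxξ⟩), ?_⟩
      filter_upwards [ae_restrict_of_ae_restrict_of_subset inter_subset_left hUη,
        ae_restrict_of_ae_restrict_of_subset inter_subset_right (hgrad ξ hξ)] with y h3 h4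
      rw [h4, h3]
    · exact Or.inl ⟨hx, h⟩
  · rw [setLIntegral_eq_sum_region hD hS, setLIntegral_eq_sum_region hD hS]
    refine Finset.sum_le_sum fun ξ hξ => ?_
    rw [setLIntegral_region (gradMat φ) (fun G => relaxed b W (F + G) + ε) ξ]
    refine le_trans (lintegral_mono_ae ?_) (hψle ξ)
    filter_upwards [hgrad ξ hξ] with x hx
    rw [hx, add_assoc]

/-- For either value of `b` the inequality is obtained here for maps with finitely many gradients
only, since near-optimal maps are inserted gradient by gradient. -/
lemma relaxed_mul_le_of_finGrad {b : Prop} {W : Mat m N → ℝ≥0∞} (hW : Measurable W)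
    (hfin : ∀ F, relaxed b W F ≠ ⊤) {D : Set (Eucl N)} (hD : IsOpen D)
    (hb : Bornology.IsBounded D) (hfr : volume (frontier D) = 0) (F : Mat m N)
    {φ : Eucl N → Eucl m} (hφ : IsTest True D φ) :
    relaxed b W F * volume D ≤ ∫⁻ x in D, relaxed b W (F + gradMat φ x) := by
  refine ENNReal.le_of_forall_pos_le_add fun ε hε _ => ?_
  -- If `volume D = 0` the quotient is `⊤`; it is still nonzero, and its product with `volume D` is
  -- still at most `ε`.
  have hε' : (ε : ℝ≥0∞) / volume D ≠ 0 :=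
    ENNReal.div_ne_zero.2 ⟨by exact_mod_cast hε.ne', hb.measure_lt_top.ne⟩
  obtain ⟨χ, hχ, hle⟩ := exists_isTest_refine hW hfin hD F hφ hε'
  refine (relaxed_mul_le hW hD hb hfr F hχ).trans (hle.trans ?_)
  rw [lintegral_add_right _ measurable_const, setLIntegral_const]
  gcongr
  exact ENNReal.mul_le_of_le_div le_rfl

lemma matCLM_sub (A B : Mat m N) : matCLM (A - B) = matCLM A - matCLM B := by
  ext x i
  simp [matCLM_apply, sub_mul, Finset.sum_sub_distrib]

lemma matCLM_add (A B : Mat m N) : matCLM (A + B) = matCLM A + matCLM B := by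
  ext x i
  simp [matCLM_apply, add_mul, Finset.sum_add_distrib]

lemma sub_matCLM_eventuallyEq {v : Eucl N → Eucl m} {x a : Eucl N} {c : Eucl m} {ξ : Mat m N}
    (h : v =ᶠ[𝓝 x] fun y => c + matCLM ξ (y - a)) (F : Mat m N) :
    (fun y => v y - matCLM F y) =ᶠ[𝓝 x]
      fun y => (c - matCLM F a) + matCLM (ξ - F) (y - a) := by
  filter_upwards [h] with y hy
  rw [hy, matCLM_sub]
  simp only [_root_.sub_apply, map_sub]
  abel

lemma mem_gradRegion_of_affine {φ : Eucl N → Eucl m} {x a : Eucl N} {c : Eucl m} {ξ : Mat m N}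
    (h : φ =ᶠ[𝓝 x] fun y => c + matCLM ξ (y - a)) : x ∈ gradRegion (gradMat φ) ξ := by
  obtain ⟨U, hU, hUo, hxU⟩ := eventually_nhds_iff.1 h
  refine ⟨U, hUo.mem_nhds hxU, ?_⟩
  filter_upwards [ae_restrict_mem hUo.measurableSet] with y hy
  refine gradMat_of_affine (b := c) (a := a) ?_
  filter_upwards [hUo.mem_nhds hy] with z hz
  exact hU z hz

/-- Upper bound for the relaxed energy by a map which is affine on finitely many balls; the
remaining part of the domain is filled with gradients from a fixed finite set. -/
lemma relaxed_mul_le_of_patch (hN : 0 < N) {b : Prop} {W : Mat m N → ℝ≥0∞} (hW : Measurable W)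
    (hfin : ∀ F, relaxed b W F ≠ ⊤) {D : Set (Eucl N)} (hD : IsOpen D)
    (hb : Bornology.IsBounded D) (hfr : volume (frontier D) = 0) (F : Mat m N)
    (t : Finset (Eucl N)) (ρ : Eucl N → ℝ) (hρ : ∀ x ∈ t, Metric.closedBall x (ρ x) ⊆ D)
    (hdisj : (t : Set (Eucl N)).PairwiseDisjoint fun x => Metric.closedBall x (ρ x))
    (hρ0 : ∀ x ∈ t, 0 < ρ x)
    (A : Eucl N → Mat m N) (c : Eucl N → Eucl m) {L : ℝ≥0} (hL : 0 < L) {w : Eucl N → Eucl m}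
    (hw : LipschitzOnWith L w (Dᶜ ∪ ⋃ x ∈ t, Metric.closedBall x (ρ x)))
    (hwF : ∀ x ∉ D, w x = matCLM F x)
    (hwA : ∀ x ∈ t, ∀ y ∈ Metric.closedBall x (ρ x), w y = c x + matCLM (A x) (y - x))
    {M : ℝ≥0∞} (hM : ∀ ξ ∈ slopeSet m N L, relaxed b W ξ ≤ M) :
    relaxed b W F * volume D ≤
      ∑ x ∈ t, relaxed b W (A x) * volume (Metric.closedBall x (ρ x)) +
        M * volume (D \ ⋃ x ∈ t, Metric.closedBall x (ρ x)) := by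
  classical
  set B : Set (Eucl N) := ⋃ x ∈ t, Metric.closedBall x (ρ x) with hB
  have hBc : IsClosed B := t.finite_toSet.isClosed_biUnion fun x _ => Metric.isClosed_closedBall
  have hBD : B ⊆ D := iUnion₂_subset hρ
  have hV : IsOpen (D \ B) := hD.sdiff hBc
  have hVb : Bornology.IsBounded (D \ B) := hb.subset sdiff_subset
  have hVc : (D \ B)ᶜ = Dᶜ ∪ B := by rw [compl_sdiff, union_comm]
  obtain ⟨v, ⟨K, hK⟩, hvw, hae⟩ := exists_fill hVb hV (compl_nonempty_of_isBounded hN hVb) hL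
    (by rw [hVc]; exact hw)
  have hvB : ∀ x ∈ B, v x = w x := fun x hx => hvw x fun h => h.2 hx
  have hvD : ∀ x ∉ D, v x = w x := fun x hx => hvw x fun h => hx h.1
  -- Subtracting the boundary map gives a test map on `D` for which `F + gradMat φ` is the gradient
  -- of `v`.
  set φ : Eucl N → Eucl m := fun y => v y - matCLM F y with hφdef
  have hball : ∀ x ∈ t, ∀ y ∈ Metric.ball x (ρ x),
      φ =ᶠ[𝓝 y] fun z => (c x - matCLM F x) + matCLM (A x - F) (z - x) := by
    intro x hx y hy
    refine sub_matCLM_eventuallyEq ?_ F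
    filter_upwards [Metric.isOpen_ball.mem_nhds hy] with z hz
    have hz' := Metric.ball_subset_closedBall hz
    rw [hvB z (mem_iUnion₂.2 ⟨x, hx, hz'⟩), hwA x hx z hz']
  have hsph : ∀ x ∈ t, ∀ᵐ y ∂volume.restrict (Metric.closedBall x (ρ x)),
      y ∈ Metric.ball x (ρ x) := by
    intro x hx
    rw [ae_restrict_iff' Metric.isClosed_closedBall.measurableSet]
    have h0 := Measure.addHaar_sphere_of_ne_zero (volume : Measure (Eucl N)) x (hρ0 x hx).ne'
    rw [← compl_mem_ae_iff] at h0
    filter_upwards [h0] with y hy hy'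
    exact lt_of_le_of_ne hy' hy
  have hFG : FinGrad D (gradMat φ) := by
    refine ⟨(finite_slopeSet (m := m) (N := N) L).toFinset.image (fun ξ => ξ - F) ∪
      t.image fun x => A x - F, ?_⟩
    have h1 : ∀ᵐ x ∂volume.restrict D, x ∈ D \ B →
        ∃ ξ ∈ slopeSet m N L, v =ᶠ[𝓝 x] fun y => v x + matCLM ξ (y - x) := by
      rw [ae_restrict_iff' hV.measurableSet] at hae
      exact ae_restrict_of_ae hae
    have h2 : ∀ᵐ y ∂volume.restrict D, ∀ x ∈ t, y ∈ Metric.closedBall x (ρ x) →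
        y ∈ Metric.ball x (ρ x) := by
      refine ae_restrict_of_ae ?_
      refine (ae_ball_iff t.countable_toSet).2 fun x hx => ?_
      exact (ae_restrict_iff' Metric.isClosed_closedBall.measurableSet).1 (hsph x hx)
    have h3 : ∀ᵐ x ∂volume.restrict D, x ∈ ⋃ ξ ∈
        (finite_slopeSet (m := m) (N := N) L).toFinset.image (fun ξ => ξ - F) ∪
          t.image fun x => A x - F, gradRegion (gradMat φ) ξ := by
      filter_upwards [h1, h2, ae_restrict_mem hD.measurableSet] with y hy1 hy2 hyD
      by_cases hyB : y ∈ B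
      · obtain ⟨x, hx, hyx⟩ := mem_iUnion₂.1 hyB
        exact mem_iUnion₂.2 ⟨A x - F, Finset.mem_union_right _ (Finset.mem_image_of_mem _ hx),
          mem_gradRegion_of_affine (hball x hx y (hy2 x hx hyx))⟩
      · obtain ⟨ξ, hξ, hev⟩ := hy1 ⟨hyD, hyB⟩
        exact mem_iUnion₂.2 ⟨ξ - F, Finset.mem_union_left _
          (Finset.mem_image_of_mem _ ((finite_slopeSet L).mem_toFinset.2 hξ)),
          mem_gradRegion_of_affine (sub_matCLM_eventuallyEq hev F)⟩
    rw [ae_restrict_iff' hD.measurableSet, ae_iff] at h3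
    refine measure_mono_null ?_ h3
    rintro x ⟨hx, hx'⟩ h
    exact hx' (h hx)
  have htest : IsTest True D φ :=
    ⟨⟨_, hK.sub (matCLM F).lipschitz⟩, fun x hx => by
      simp only [hφdef, hvD x hx, hwF x hx, sub_self], fun _ => hFG⟩
  refine (relaxed_mul_le_of_finGrad hW hfin hD hb hfr F htest).trans ?_
  have hsplit : D = B ∪ D \ B := (union_sdiff_cancel hBD).symm
  have hB' : ∫⁻ x in B, relaxed b W (F + gradMat φ x) =
      ∑ x ∈ t, relaxed b W (A x) * volume (Metric.closedBall x (ρ x)) := by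
    rw [hB, lintegral_biUnion_finset hdisj fun x _ => Metric.isClosed_closedBall.measurableSet]
    refine Finset.sum_congr rfl fun x hx => ?_
    rw [← setLIntegral_const]
    refine lintegral_congr_ae ?_
    filter_upwards [hsph x hx] with y hy
    rw [gradMat_of_affine (hball x hx y hy), add_sub_cancel]
  have hV' : ∫⁻ x in D \ B, relaxed b W (F + gradMat φ x) ≤ M * volume (D \ B) := by
    rw [← setLIntegral_const]
    refine lintegral_mono_ae ?_
    filter_upwards [hae] with x hx
    obtain ⟨ξ, hξ, hev⟩ := hx
    rw [gradMat_of_affine (sub_matCLM_eventuallyEq hev F), add_sub_cancel]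
    exact hM ξ hξ
  rw [hsplit, lintegral_union hV.measurableSet disjoint_sdiff_right, ← hsplit, hB']
  gcongr

end RelaxedEnergy

/-! ### Continuity and quasiconvexity of the relaxed energy. -/

section Quasiconvexity

variable {m N : ℕ}

/-- The fraction of the volume of a ball lost when its radius is multiplied by `1 - δ`. -/
noncomputable def shellFraction (N : ℕ) (δ : ℝ) : ℝ≥0∞ :=
  ENNReal.ofReal (1 - (1 - δ) ^ Module.finrank ℝ (Eucl N))

lemma tendsto_shellFraction : Tendsto (shellFraction N) (𝓝[>] 0) (𝓝 0) := by
  have h : Continuous (shellFraction N) := by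
    unfold shellFraction
    exact ENNReal.continuous_ofReal.comp (by fun_prop)
  have h0 : shellFraction N 0 = 0 := by simp [shellFraction]
  have := h.tendsto 0
  rw [h0] at this
  exact this.mono_left nhdsWithin_le_nhds

lemma volume_shell (x : Eucl N) {r δ : ℝ} (hr : 0 ≤ r) (hδ : 0 < δ) (hδ1 : δ < 1) :
    volume (Metric.closedBall x r \ Metric.closedBall x ((1 - δ) * r)) =
      shellFraction N δ * volume (Metric.closedBall x r) := by
  have h1 : (1 - δ) * r ≤ r := by nlinarith
  have h0 : 0 ≤ 1 - δ := by linarith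
  rw [measure_sdiff (Metric.closedBall_subset_closedBall h1)
    Metric.isClosed_closedBall.measurableSet.nullMeasurableSet measure_closedBall_lt_top.ne,
    Measure.addHaar_closedBall_mul volume x h0, Measure.addHaar_closedBall_center volume x r,
    shellFraction, ENNReal.ofReal_sub _ (by positivity), ENNReal.sub_mul, ENNReal.ofReal_one,
    one_mul]
  · intro _ _
    exact measure_closedBall_lt_top.ne
  · exact hr

/-- The bound depends on `L` alone, so it stays fixed when `δ` tends to zero. -/
lemma exists_relaxed_bound {b : Prop} {W : Mat m N → ℝ≥0∞} (hfin : ∀ F, relaxed b W F ≠ ⊤)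
    (L : ℝ≥0) : ∃ M : ℝ≥0∞, M ≠ ⊤ ∧ ∀ ξ ∈ slopeSet m N L, relaxed b W ξ ≤ M := by
  refine ⟨∑ ξ ∈ (finite_slopeSet L).toFinset, relaxed b W ξ, ?_, fun ξ hξ => ?_⟩
  · exact ENNReal.sum_ne_top.2 fun ξ _ => hfin ξ
  · exact Finset.single_le_sum (f := fun ξ => relaxed b W ξ) (fun _ _ => zero_le)
      ((finite_slopeSet L).mem_toFinset.2 hξ)

/-- The competitor for `F'` on the unit ball has gradient `F` on the concentric ball of radius `1 -
δ`, and the shell is filled. The mismatch `(F - F') y` is at most `δ`, the width of the shell, so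
the data are Lipschitz with constant `K + 1` however small `δ` is. -/
lemma relaxed_le_add (hN : 0 < N) {b : Prop} {W : Mat m N → ℝ≥0∞} (hW : Measurable W)
    (hfin : ∀ F, relaxed b W F ≠ ⊤) {F F' : Mat m N} {K : ℝ≥0} {δ : ℝ} (hδ : 0 < δ) (hδ1 : δ < 1)
    (hF' : ‖matCLM F'‖ ≤ K) (hFF' : ‖matCLM (F - F')‖ ≤ δ) {M : ℝ≥0∞}
    (hM : ∀ ξ ∈ slopeSet m N (K + 1), relaxed b W ξ ≤ M) :
    relaxed b W F' ≤ relaxed b W F + shellFraction N δ * M := by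
  classical
  set B : Set (Eucl N) := Metric.closedBall 0 (1 - δ) with hB
  have hB1 : B ⊆ Metric.ball 0 1 := Metric.closedBall_subset_ball (by linarith)
  let χ : Eucl N → Eucl m := fun y => if y ∈ B then matCLM (F - F') y else 0
  have hχ1 : ∀ y ∈ B, ‖χ y‖ ≤ δ := by
    intro y hy
    simp only [χ, if_pos hy]
    refine ((matCLM (F - F')).le_opNorm y).trans ?_
    have h1 : ‖y‖ ≤ 1 := (mem_ball_zero_iff.1 (hB1 hy)).le
    have := norm_nonneg y
    nlinarith
  have hcross : ∀ x ∈ B, ∀ y ∉ Metric.ball (0 : Eucl N) 1, dist (χ x) (χ y) ≤ dist x y := by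
    intro x hx y hy
    have hyB : y ∉ B := fun h => hy (hB1 h)
    have h1 : χ y = 0 := if_neg hyB
    rw [h1, dist_zero_right]
    refine (hχ1 x hx).trans ?_
    rw [mem_ball_zero_iff, not_lt] at hy
    rw [hB, mem_closedBall_zero_iff] at hx
    have h2 := norm_sub_norm_le y x
    rw [dist_comm, dist_eq_norm]
    linarith
  have hχL : LipschitzOnWith 1 χ ((Metric.ball 0 1)ᶜ ∪ B) := by
    refine LipschitzOnWith.of_dist_le_mul fun x hx y hy => ?_
    rw [NNReal.coe_one, one_mul]
    rcases hx with hx | hx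
    · rcases hy with hy | hy
      · have h1 : χ x = 0 := if_neg fun h => hx (hB1 h)
        have h2 : χ y = 0 := if_neg fun h => hy (hB1 h)
        rw [h1, h2, dist_self]
        exact dist_nonneg
      · rw [dist_comm, dist_comm x]
        exact hcross y hy x hx
    · rcases hy with hy | hy
      · exact hcross x hx y hy
      · simp only [χ, if_pos hx, if_pos hy]
        rw [dist_eq_norm, dist_eq_norm, ← map_sub]
        refine ((matCLM (F - F')).le_opNorm _).trans ?_
        have := norm_nonneg (x - y)
        nlinarith
  have hlin : LipschitzWith K (matCLM F') := (matCLM F').lipschitz.weaken hF'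
  have hpatch := relaxed_mul_le_of_patch hN hW hfin Metric.isOpen_ball Metric.isBounded_ball
    ((convex_ball (0 : Eucl N) 1).addHaar_frontier volume) F' {0} (fun _ => 1 - δ)
    (by simpa using hB1) (by simp) (by simpa using hδ1) (fun _ => F) (fun _ => 0)
    (L := K + 1) (by positivity) (w := fun y => matCLM F' y + χ y)
    (by simpa using (hlin.lipschitzOnWith (s := (Metric.ball 0 1)ᶜ ∪ B)).add hχL)
    (fun x hx => by
      have h1 : χ x = 0 := if_neg fun h => hx (hB1 h)
      rw [h1, add_zero])
    (fun x hx y hy => by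
      obtain rfl : x = 0 := by simpa using hx
      have h1 : χ y = matCLM (F - F') y := if_pos hy
      rw [h1, matCLM_sub]
      simp) hM
  simp only [Finset.sum_singleton, Finset.mem_singleton, iUnion_iUnion_eq_left] at hpatch
  set κ := volume (Metric.ball (0 : Eucl N) 1) with hκ
  have hκ0 : κ ≠ 0 := (Metric.measure_ball_pos volume _ one_pos).ne'
  have hκt : κ ≠ ⊤ := measure_ball_lt_top.ne
  have h1 : volume (Metric.closedBall (0 : Eucl N) (1 - δ)) ≤ κ := measure_mono hB1
  have h2 : volume (Metric.ball (0 : Eucl N) 1 \ Metric.closedBall 0 (1 - δ)) ≤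
      shellFraction N δ * κ := by
    rw [hκ, ← Measure.addHaar_unitClosedBall_eq_addHaar_unitBall, ← volume_shell 0 zero_le_one hδ hδ1,
      mul_one]
    exact measure_mono (sdiff_subset_sdiff_left Metric.ball_subset_closedBall)
  have h3 : relaxed b W F' * κ ≤ (relaxed b W F + shellFraction N δ * M) * κ := by
    refine hpatch.trans ?_
    rw [add_mul]
    refine add_le_add (by gcongr) ?_
    rw [mul_comm (shellFraction N δ) M, mul_assoc]
    gcongr
  exact (ENNReal.mul_le_mul_iff_left hκ0 hκt).1 h3

lemma continuous_relaxed (hN : 0 < N) {b : Prop} {W : Mat m N → ℝ≥0∞} (hW : Measurable W)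
    (hfin : ∀ F, relaxed b W F ≠ ⊤) : Continuous (relaxed b W) := by
  rw [continuous_iff_continuousAt]
  intro F
  -- `‖matCLM F‖₊ + 1` bounds both `F` and the nearby `G`, since the estimate is used in both
  -- directions; the last `1` comes from `relaxed_le_add`.
  obtain ⟨M, hMt, hM⟩ := exists_relaxed_bound hfin (‖matCLM F‖₊ + 1 + 1)
  refine (ENNReal.tendsto_nhds (hfin F)).2 fun ε hε => ?_
  have hlim : Tendsto (fun δ => shellFraction N δ * M) (𝓝[>] 0) (𝓝 0) := by
    have := ENNReal.Tendsto.mul_const (tendsto_shellFraction (N := N)) (b := M) (Or.inr hMt)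
    rwa [zero_mul] at this
  obtain ⟨δ, ⟨hδε, hδ1⟩, hδ⟩ := ((hlim.eventually (gt_mem_nhds hε)).and
    (nhdsWithin_le_nhds (gt_mem_nhds (show (0 : ℝ) < 1 from one_pos)))).and
      self_mem_nhdsWithin |>.exists
  have hδ : 0 < δ := hδ
  have hcont : Tendsto (fun G => ‖matCLM (F - G)‖) (𝓝 F) (𝓝 0) := by
    have h1 : Continuous fun G : Mat m N => ‖matCLM (F - G)‖ :=
      (continuous_matCLM.comp (continuous_const.sub continuous_id)).norm
    have := h1.tendsto F
    rwa [sub_self, ← sub_self F, matCLM_sub, sub_self, norm_zero] at this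
  filter_upwards [hcont.eventually (gt_mem_nhds hδ)] with G hG
  have hGn : ‖matCLM (G - F)‖ ≤ δ := by
    rw [matCLM_sub, norm_sub_rev, ← matCLM_sub]; exact hG.le
  have hGK : ‖matCLM G‖ ≤ ‖matCLM F‖ + 1 := by
    have h1 : matCLM G = matCLM F + matCLM (G - F) := by rw [matCLM_sub]; abel
    rw [h1]
    exact (norm_add_le _ _).trans (by linarith)
  constructor
  · rw [tsub_le_iff_right]
    refine (relaxed_le_add hN hW hfin hδ hδ1 (K := ‖matCLM F‖₊ + 1) (by push_cast; linarith)
      hGn hM).trans ?_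
    gcongr
  · refine (relaxed_le_add hN hW hfin hδ hδ1 (K := ‖matCLM F‖₊ + 1) (by push_cast; exact hGK)
      hG.le hM).trans ?_
    gcongr

/-- Finitely many disjoint good balls fill a set up to a small part. -/
lemma exists_finset_closedBall {D : Set (Eucl N)} (hDt : volume D ≠ ⊤)
    {good : Eucl N → Set ℝ} (hsub : ∀ x, ∀ r ∈ good x, Metric.closedBall x r ⊆ D)
    (hgood : ∀ᵐ x ∂volume.restrict D, ∀ᶠ r in 𝓝[>] (0 : ℝ), r ∈ good x)
    (hD : MeasurableSet D) {ε : ℝ≥0∞} (hε : ε ≠ 0) :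
    ∃ (t : Finset (Eucl N)) (r : Eucl N → ℝ), (∀ x ∈ t, 0 < r x ∧ r x ∈ good x) ∧
      (t : Set (Eucl N)).PairwiseDisjoint (fun x => Metric.closedBall x (r x)) ∧
      volume (D \ ⋃ x ∈ t, Metric.closedBall x (r x)) ≤ ε := by
  classical
  let s : Set (Eucl N) := {x | x ∈ D ∧ ∀ᶠ r in 𝓝[>] (0 : ℝ), r ∈ good x}
  have hsD : volume (D \ s) = 0 := by
    rw [ae_restrict_iff' hD, ae_iff] at hgood
    refine measure_mono_null ?_ hgood
    rintro x ⟨hx, hx'⟩ h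
    exact hx' ⟨hx, h hx⟩
  obtain ⟨T, r, hTc, hTs, hTr, hTn, hTd⟩ := Besicovitch.exists_disjoint_closedBall_covering_ae
    volume good s (fun x hx δ hδ => by
      obtain ⟨ρ, h1, h2⟩ := (hx.2.and (Ioo_mem_nhdsGT hδ)).exists
      exact ⟨ρ, h1, h2⟩) (fun _ => 1) (fun _ _ => one_pos)
  -- Disjoint balls in a set of finite measure have summable volumes, so all but finitely many may
  -- be dropped.
  have hsum : ∑' x : T, volume (Metric.closedBall (x : Eucl N) (r x)) ≠ ⊤ := by
    rw [← measure_biUnion hTc hTd fun x _ => Metric.isClosed_closedBall.measurableSet]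
    exact ne_top_of_le_ne_top hDt
      (measure_mono (iUnion₂_subset fun x hx => hsub x _ (hTr x hx).1))
  have htail := ENNReal.tendsto_tsum_compl_atTop_zero hsum
  obtain ⟨t, ht⟩ := (htail.eventually (ge_mem_nhds (pos_iff_ne_zero.2 hε))).exists
  have hmem : ∀ x ∈ t.map (Function.Embedding.subtype _), x ∈ T := by
    intro x hx
    obtain ⟨y, -, rfl⟩ := Finset.mem_map.1 hx
    exact y.2
  refine ⟨t.map (Function.Embedding.subtype _), r,
    fun x hx => ⟨(hTr x (hmem x hx)).2.1, (hTr x (hmem x hx)).1⟩,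
    hTd.subset fun x hx => hmem x hx, ?_⟩
  have hcov : D \ ⋃ x ∈ t.map (Function.Embedding.subtype _), Metric.closedBall x (r x) ⊆
      (D \ s ∪ (s \ ⋃ x ∈ T, Metric.closedBall x (r x))) ∪
        ⋃ x : {x : T // x ∉ t}, Metric.closedBall (x : Eucl N) (r x) := by
    rintro y ⟨hy, hy'⟩
    by_cases hys : y ∈ s
    · by_cases hyT : y ∈ ⋃ x ∈ T, Metric.closedBall x (r x)
      · right
        obtain ⟨x, hx, hyx⟩ := mem_iUnion₂.1 hyT
        refine mem_iUnion.2 ⟨⟨⟨x, hx⟩, fun hxt => hy' ?_⟩, hyx⟩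
        exact mem_iUnion₂.2 ⟨x, Finset.mem_map.2 ⟨⟨x, hx⟩, hxt, rfl⟩, hyx⟩
      · exact Or.inl (Or.inr ⟨hys, hyT⟩)
    · exact Or.inl (Or.inl ⟨hy, hys⟩)
  have : Countable T := hTc.to_subtype
  calc _ ≤ _ := measure_mono hcov
    _ ≤ volume (D \ s ∪ (s \ ⋃ x ∈ T, Metric.closedBall x (r x))) +
        volume (⋃ x : {x : T // x ∉ t}, Metric.closedBall (x : Eucl N) (r x)) :=
        measure_union_le _ _
    _ ≤ 0 + ∑' x : {x : T // x ∉ t}, volume (Metric.closedBall (x : Eucl N) (r x)) := by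
        rw [measure_union_null hsD hTn]
        gcongr
        exact measure_iUnion_le _
    _ ≤ ε := by rw [zero_add]; exact ht

/-- Lebesgue differentiation. The `ε` stands inside the integral, so summing over disjoint balls
costs `ε` times their total volume. -/
lemma ae_eventually_average {h : Eucl N → ℝ≥0∞} (hm : Measurable h) (hi : ∫⁻ x, h x ≠ ⊤)
    {ε : ℝ≥0∞} (hε : ε ≠ 0) : ∀ᵐ x : Eucl N, h x ≠ ⊤ → ∀ᶠ r in 𝓝[>] (0 : ℝ),
      h x * volume (Metric.closedBall x r) ≤
        ∫⁻ y in Metric.closedBall x r, h y + ε := by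
  filter_upwards [(Besicovitch.vitaliFamily (volume : Measure (Eucl N))).ae_tendsto_lintegral_div
    hm.aemeasurable hi] with x hx hxt
  have h1 := hx.comp (Besicovitch.tendsto_filterAt volume x)
  filter_upwards [(ENNReal.tendsto_nhds hxt).1 h1 ε (pos_iff_ne_zero.2 hε), self_mem_nhdsWithin]
    with r hr hr0
  have h2 : h x ≤ (∫⁻ y in Metric.closedBall x r, h y) / volume (Metric.closedBall x r) + ε :=
    tsub_le_iff_right.1 hr.1
  rw [lintegral_add_right _ measurable_const, setLIntegral_const]
  calc h x * volume (Metric.closedBall x r) ≤ _ := mul_le_mul_left h2 _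
    _ = _ := by
      rw [add_mul, ENNReal.div_mul_cancel
        (Metric.measure_closedBall_pos volume x hr0).ne' measure_closedBall_lt_top.ne]

lemma eventually_closedBall_differentiable {φ : Eucl N → Eucl m} {x : Eucl N}
    (h : DifferentiableAt ℝ φ x) {δ : ℝ} (hδ : 0 < δ) : ∀ᶠ r in 𝓝[>] (0 : ℝ),
      ∀ y ∈ Metric.closedBall x r, ‖φ y - (φ x + fderiv ℝ φ x (y - x))‖ ≤ δ * r := by
  have h1 := h.hasFDerivAt.isLittleO.def hδ
  obtain ⟨r₀, hr₀, hball⟩ := Metric.eventually_nhds_iff_ball.1 h1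
  filter_upwards [Ioo_mem_nhdsGT hr₀] with r hr y hy
  rw [Metric.mem_closedBall] at hy
  have := hball y (lt_of_le_of_lt hy hr.2)
  rw [← sub_sub]
  refine this.trans ?_
  rw [← dist_eq_norm]
  gcongr

/-- On each ball shrunk by the factor `1 - δ`, `φ` is replaced by its first-order expansion. The
error `δ * r x` is at most the gap between the shrunken ball and any other part of the prescribed
set, so it adds at most 1 to the Lipschitz constant at each of two points: `K + 2`, independent of
`δ`. The remainder, including the shells, is filled at cost `M`. -/
lemma relaxed_mul_le_of_balls (hN : 0 < N) {b : Prop} {W : Mat m N → ℝ≥0∞} (hW : Measurable W)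
    (hfin : ∀ F, relaxed b W F ≠ ⊤) {D : Set (Eucl N)} (hD : IsOpen D)
    (hb : Bornology.IsBounded D) (hfr : volume (frontier D) = 0) (F : Mat m N)
    {φ : Eucl N → Eucl m} {K : ℝ≥0} (hK : LipschitzWith K φ) (hφ0 : ∀ x ∉ D, φ x = 0)
    {δ : ℝ} (hδ : 0 < δ) (hδ1 : δ < 1) (t : Finset (Eucl N)) (r : Eucl N → ℝ)
    (hr : ∀ x ∈ t, 0 < r x) (hrD : ∀ x ∈ t, Metric.closedBall x (r x) ⊆ D)
    (hdisj : (t : Set (Eucl N)).PairwiseDisjoint fun x => Metric.closedBall x (r x))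
    (happ : ∀ x ∈ t, ∀ y ∈ Metric.closedBall x (r x),
      ‖φ y - (φ x + fderiv ℝ φ x (y - x))‖ ≤ δ * r x)
    {M : ℝ≥0∞} (hM : ∀ ξ ∈ slopeSet m N (‖matCLM F‖₊ + (K + 2)), relaxed b W ξ ≤ M) :
    relaxed b W F * volume D ≤
      ∑ x ∈ t, relaxed b W (F + gradMat φ x) * volume (Metric.closedBall x (r x)) +
        M * (volume (D \ ⋃ x ∈ t, Metric.closedBall x (r x)) + shellFraction N δ * volume D) := by
  classical
  let ρ : Eucl N → ℝ := fun x => (1 - δ) * r x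
  have hρ0 : ∀ x ∈ t, 0 < ρ x := fun x hx => mul_pos (by linarith) (hr x hx)
  have hρr : ∀ x ∈ t, Metric.closedBall x (ρ x) ⊆ Metric.closedBall x (r x) := fun x hx =>
    Metric.closedBall_subset_closedBall (by
      change (1 - δ) * r x ≤ r x
      nlinarith [hr x hx])
  have hdisj' : (t : Set (Eucl N)).PairwiseDisjoint fun x => Metric.closedBall x (ρ x) :=
    fun x hx y hy hxy => (hdisj hx hy hxy).mono (hρr x hx) (hρr y hy)
  let χ : Eucl N → Eucl m := fun y =>
    if h : ∃ x ∈ t, y ∈ Metric.closedBall x (ρ x) then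
      φ h.choose + fderiv ℝ φ h.choose (y - h.choose) else 0
  have hχt : ∀ x ∈ t, ∀ y ∈ Metric.closedBall x (ρ x), χ y = φ x + fderiv ℝ φ x (y - x) := by
    intro x hx y hy
    have h : ∃ x ∈ t, y ∈ Metric.closedBall x (ρ x) := ⟨x, hx, hy⟩
    have hxe : h.choose = x := by
      by_contra hne
      exact Set.disjoint_left.1 (hdisj' h.choose_spec.1 hx hne) h.choose_spec.2 hy
    simp only [χ, dif_pos h, hxe]
  have hχ0 : ∀ y ∉ D, χ y = 0 := by
    intro y hy
    have h : ¬ ∃ x ∈ t, y ∈ Metric.closedBall x (ρ x) := by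
      rintro ⟨x, hx, hyx⟩
      exact hy (hrD x hx (hρr x hx hyx))
    simp only [χ, dif_neg h]
  set E : Set (Eucl N) := Dᶜ ∪ ⋃ x ∈ t, Metric.closedBall x (ρ x) with hE
  have herr : ∀ x ∈ t, ∀ y ∈ Metric.closedBall x (ρ x), ∀ z ∈ E,
      -- Such a `z` even lies outside the full ball of radius `r x`, since the full balls are
      -- disjoint and contained in `D`.
      z ∉ Metric.closedBall x (ρ x) → ‖φ y - χ y‖ ≤ dist y z := by
    intro x hx y hy z hz hzx
    have hzr : z ∉ Metric.closedBall x (r x) := by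
      intro h
      rcases hz with hz | hz
      · exact hz (hrD x hx h)
      · obtain ⟨x', hx', hzx'⟩ := mem_iUnion₂.1 hz
        have hne : x ≠ x' := by
          rintro rfl
          exact hzx hzx'
        exact Set.disjoint_left.1 (hdisj hx hx' hne) h (hρr x' hx' hzx')
    rw [hχt x hx y hy]
    refine (happ x hx y (hρr x hx hy)).trans ?_
    rw [Metric.mem_closedBall, not_le] at hzr
    have h1 : dist y x ≤ (1 - δ) * r x := hy
    have h2 := dist_triangle z y x
    rw [dist_comm z y] at h2
    linarith
  have herr' : ∀ y ∈ E, ∀ z ∈ E, (¬ ∃ x ∈ t, y ∈ Metric.closedBall x (ρ x) ∧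
      z ∈ Metric.closedBall x (ρ x)) → ‖φ y - χ y‖ ≤ dist y z := by
    intro y hy z hz hyz
    rcases hy with hy | hy
    · rw [hφ0 y hy, hχ0 y hy, sub_self, norm_zero]
      exact dist_nonneg
    · obtain ⟨x, hx, hyx⟩ := mem_iUnion₂.1 hy
      exact herr x hx y hyx z hz fun hzx => hyz ⟨x, hx, hyx, hzx⟩
  have hχL : LipschitzOnWith (K + 2) χ E := by
    refine LipschitzOnWith.of_dist_le_mul fun y hy z hz => ?_
    push_cast
    by_cases hyz : ∃ x ∈ t, y ∈ Metric.closedBall x (ρ x) ∧ z ∈ Metric.closedBall x (ρ x)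
    · obtain ⟨x, hx, hyx, hzx⟩ := hyz
      rw [hχt x hx y hyx, hχt x hx z hzx, dist_add_left, dist_eq_norm, ← map_sub,
        sub_sub_sub_cancel_right]
      refine ((fderiv ℝ φ x).le_opNorm _).trans ?_
      have h1 := norm_fderiv_le_of_lipschitz ℝ hK (x₀ := x)
      rw [← dist_eq_norm]
      gcongr
      linarith
    · have h1 := herr' y hy z hz hyz
      have h2 := herr' z hz y hy fun ⟨x, hx, h3, h4⟩ => hyz ⟨x, hx, h4, h3⟩
      have h3 := hK.dist_le_mul y z
      have h4 := dist_triangle4 (χ y) (φ y) (φ z) (χ z)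
      rw [← dist_eq_norm, dist_comm] at h1
      rw [← dist_eq_norm, dist_comm z y] at h2
      linarith
  have hpatch := relaxed_mul_le_of_patch hN hW hfin hD hb hfr F t ρ
    (fun x hx => (hρr x hx).trans (hrD x hx)) hdisj' hρ0 (fun x => F + gradMat φ x)
    (fun x => matCLM F x + φ x) (L := ‖matCLM F‖₊ + (K + 2)) (by positivity)
    (w := fun y => matCLM F y + χ y)
    ((matCLM F).lipschitz.lipschitzOnWith.add hχL)
    (fun x hx => by rw [hχ0 x hx, add_zero])
    (fun x hx y hy => by
      rw [hχt x hx y hy, matCLM_add, gradMat, matCLM_toMat]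
      simp only [_root_.add_apply, map_sub]
      abel) hM
  refine hpatch.trans ?_
  refine add_le_add (Finset.sum_le_sum fun x hx => mul_le_mul_right
    (measure_mono (hρr x hx)) _) ?_
  gcongr
  have hcov : D \ ⋃ x ∈ t, Metric.closedBall x (ρ x) ⊆
      (D \ ⋃ x ∈ t, Metric.closedBall x (r x)) ∪
        ⋃ x ∈ t, (Metric.closedBall x (r x) \ Metric.closedBall x (ρ x)) := by
    rintro y ⟨hy, hy'⟩
    by_cases h : y ∈ ⋃ x ∈ t, Metric.closedBall x (r x)
    · right
      obtain ⟨x, hx, hyx⟩ := mem_iUnion₂.1 h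
      exact mem_iUnion₂.2 ⟨x, hx, hyx, fun h2 => hy' (mem_iUnion₂.2 ⟨x, hx, h2⟩)⟩
    · exact Or.inl ⟨hy, h⟩
  refine (measure_mono hcov).trans ((measure_union_le _ _).trans ?_)
  gcongr
  calc volume (⋃ x ∈ t, (Metric.closedBall x (r x) \ Metric.closedBall x (ρ x)))
      ≤ ∑ x ∈ t, volume (Metric.closedBall x (r x) \ Metric.closedBall x (ρ x)) :=
        measure_biUnion_finset_le _ _
    _ = shellFraction N δ * ∑ x ∈ t, volume (Metric.closedBall x (r x)) := by
        rw [Finset.mul_sum]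
        exact Finset.sum_congr rfl fun x hx => volume_shell x (hr x hx).le hδ hδ1
    _ ≤ shellFraction N δ * volume D := by
        gcongr
        rw [← measure_biUnion_finset hdisj fun x _ => Metric.isClosed_closedBall.measurableSet]
        exact measure_mono (iUnion₂_subset hrD)

/-- Almost every point is a point of differentiability of `φ` and a Lebesgue point of the integrand
`g`, so small balls about it are good for `relaxed_mul_le_of_balls`. All error terms vanish as `δ →
0` because `M` is fixed. Continuity of `relaxed b W` enters only through the measurability of `g`.
-/
lemma relaxed_mul_le_of_lipschitz (hN : 0 < N) {b : Prop} {W : Mat m N → ℝ≥0∞}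
    (hW : Measurable W) (hfin : ∀ F, relaxed b W F ≠ ⊤) {D : Set (Eucl N)} (hD : IsOpen D)
    (hb : Bornology.IsBounded D) (hfr : volume (frontier D) = 0) (F : Mat m N)
    {φ : Eucl N → Eucl m} (hφ : IsTest False D φ) :
    relaxed b W F * volume D ≤ ∫⁻ x in D, relaxed b W (F + gradMat φ x) := by
  obtain ⟨K, hK⟩ := hφ.lip
  set g : Eucl N → ℝ≥0∞ := fun x => relaxed b W (F + gradMat φ x) with hg
  have hgm : Measurable g :=
    ((continuous_relaxed hN hW hfin).comp (continuous_const.add continuous_id)).measurable.comp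
      (measurable_gradMat φ)
  -- The remaining case has the finite integral that Lebesgue differentiation requires.
  by_cases hI : ∫⁻ x in D, g x = ⊤
  · rw [hI]; exact le_top
  have hDt : volume D ≠ ⊤ := hb.measure_lt_top.ne
  have hI' : ∫⁻ x, D.indicator g x ≠ ⊤ := by rwa [lintegral_indicator hD.measurableSet]
  obtain ⟨M, hMt, hM⟩ := exists_relaxed_bound hfin (‖matCLM F‖₊ + (K + 2))
  have hδle : ∀ δ ∈ Ioo (0 : ℝ) 1, relaxed b W F * volume D ≤
      (∫⁻ x in D, g x) + ENNReal.ofReal δ * volume D +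
        M * (ENNReal.ofReal δ + shellFraction N δ * volume D) := by
    rintro δ ⟨hδ, hδ1⟩
    have hε : ENNReal.ofReal δ ≠ 0 := by simpa using hδ
    let good : Eucl N → Set ℝ := fun x => {r | Metric.closedBall x r ⊆ D ∧
      (∀ y ∈ Metric.closedBall x r, ‖φ y - (φ x + fderiv ℝ φ x (y - x))‖ ≤ δ * r) ∧
      g x * volume (Metric.closedBall x r) ≤
        ∫⁻ y in Metric.closedBall x r, g y + ENNReal.ofReal δ}
    have hgood : ∀ᵐ x ∂volume.restrict D, ∀ᶠ r in 𝓝[>] (0 : ℝ), r ∈ good x := by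
      filter_upwards [ae_restrict_mem hD.measurableSet, ae_restrict_of_ae hK.ae_differentiableAt,
        ae_restrict_of_ae (ae_eventually_average (hgm.indicator hD.measurableSet) hI' hε)]
        with x hx hdx hax
      rw [indicator_of_mem hx] at hax
      obtain ⟨r₀, hr₀, hr₀D⟩ := Metric.nhds_basis_closedBall.mem_iff.1 (hD.mem_nhds hx)
      filter_upwards [Ioo_mem_nhdsGT hr₀, eventually_closedBall_differentiable hdx hδ,
        hax (hfin _)] with r h1 h2 h3
      have h4 : Metric.closedBall x r ⊆ D :=
        (Metric.closedBall_subset_closedBall h1.2.le).trans hr₀D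
      refine ⟨h4, h2, h3.trans (le_of_eq ?_)⟩
      refine setLIntegral_congr_fun Metric.isClosed_closedBall.measurableSet fun y hy => ?_
      rw [indicator_of_mem (h4 hy)]
    obtain ⟨t, r, htr, htd, htv⟩ := exists_finset_closedBall hDt (fun x r hr => hr.1) hgood
      hD.measurableSet hε
    refine (relaxed_mul_le_of_balls hN hW hfin hD hb hfr F hK hφ.zero hδ hδ1 t r
      (fun x hx => (htr x hx).1) (fun x hx => (htr x hx).2.1) htd
      (fun x hx => (htr x hx).2.2.1) hM).trans ?_
    gcongr
    calc ∑ x ∈ t, g x * volume (Metric.closedBall x (r x))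
        ≤ ∑ x ∈ t, ∫⁻ y in Metric.closedBall x (r x), (g y + ENNReal.ofReal δ) :=
          Finset.sum_le_sum fun x hx => (htr x hx).2.2.2
      _ = ∫⁻ y in ⋃ x ∈ t, Metric.closedBall x (r x), (g y + ENNReal.ofReal δ) :=
          (lintegral_biUnion_finset htd
            (fun x _ => Metric.isClosed_closedBall.measurableSet) _).symm
      _ ≤ ∫⁻ y in D, (g y + ENNReal.ofReal δ) :=
          lintegral_mono_set (iUnion₂_subset fun x hx => (htr x hx).2.1)
      _ = (∫⁻ x in D, g x) + ENNReal.ofReal δ * volume D := by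
          rw [lintegral_add_right _ measurable_const, setLIntegral_const]
  have hof : Tendsto (fun δ : ℝ => ENNReal.ofReal δ) (𝓝[>] 0) (𝓝 0) := by
    have := ENNReal.continuous_ofReal.tendsto 0
    rw [ENNReal.ofReal_zero] at this
    exact this.mono_left nhdsWithin_le_nhds
  have h1 : Tendsto (fun δ : ℝ => ENNReal.ofReal δ * volume D) (𝓝[>] 0) (𝓝 0) := by
    have := ENNReal.Tendsto.mul_const hof (b := volume D) (Or.inr hDt)
    rwa [zero_mul] at this
  have h2 : Tendsto (fun δ : ℝ => M * (ENNReal.ofReal δ + shellFraction N δ * volume D))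
      (𝓝[>] 0) (𝓝 0) := by
    have h3 := ENNReal.Tendsto.mul_const (tendsto_shellFraction (N := N)) (b := volume D)
      (Or.inr hDt)
    have h4 := ENNReal.Tendsto.const_mul (hof.add h3) (a := M) (Or.inr hMt)
    simpa using h4
  have hlim := (tendsto_const_nhds (x := ∫⁻ x in D, g x)).add h1 |>.add h2
  simp only [add_zero] at hlim
  refine ge_of_tendsto hlim ?_
  filter_upwards [Ioo_mem_nhdsGT (show (0 : ℝ) < 1 from one_pos)] with δ hδ
  exact hδle δ hδ

lemma isQuasiconvex_relaxed (hN : 0 < N) {b : Prop} {W : Mat m N → ℝ≥0∞}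
    (hW : Measurable W) (hfin : ∀ F, relaxed b W F ≠ ⊤) : IsQuasiconvex (relaxed b W) := by
  refine ⟨(continuous_relaxed hN hW hfin).measurable, fun D hD hb hfr F φ G h => ?_⟩
  obtain ⟨φ', hφ', hae⟩ := h.exists_isTest hD hb (compl_nonempty_of_isBounded hN hb)
  refine (relaxed_mul_le_of_lipschitz hN hW hfin hD hb hfr F hφ').trans
    (le_of_eq (lintegral_congr_ae ?_))
  filter_upwards [hae] with x hx
  rw [hx]

lemma relaxed_le (b : Prop) (W : Mat m N → ℝ≥0∞) : relaxed b W ≤ W := by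
  intro F
  have hg : ∀ x, gradMat (fun _ : Eucl N => (0 : Eucl m)) x = (0 : Mat m N) := fun x =>
    gradMat_of_affine (a := 0) (b := 0) (Eventually.of_forall fun y => by
      simp [matCLM])
  have ht : IsTest b (unitCube N) fun _ : Eucl N => (0 : Eucl m) := by
    refine ⟨⟨0, LipschitzWith.const 0⟩, fun _ _ => rfl, fun _ => ⟨{0}, ?_⟩⟩
    convert measure_empty (μ := (volume : Measure (Eucl N)))
    rw [sdiff_eq_empty]
    intro x _
    simp only [Finset.mem_singleton, iUnion_iUnion_eq_left]
    exact ⟨univ, univ_mem, Eventually.of_forall hg⟩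
  refine (iInf₂_le _ ht).trans (le_of_eq ?_)
  simp only [hg, add_zero]
  rw [setLIntegral_const, volume_unitCube, mul_one]

/-- Quasiconvexity of `g` on the unit cube, followed by `g ≤ W` under the integral. -/
lemma IsQuasiconvex.le_relaxed {g W : Mat m N → ℝ≥0∞} (hg : IsQuasiconvex g) (hgW : g ≤ W)
    (b : Prop) : g ≤ relaxed b W := by
  intro F
  refine le_iInf₂ fun φ hφ => ?_
  have h := hg.2 (unitCube N) isOpen_unitCube isBounded_unitCube volume_frontier_unitCube F φ _
    (hφ.isW1InftyZero isOpen_unitCube isBounded_unitCube)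
  rw [volume_unitCube, mul_one] at h
  exact h.trans (lintegral_mono fun x => hgW _)

lemma quasiconvexEnvelope_eq_relaxed (hN : 0 < N) {b : Prop} {W : Mat m N → ℝ≥0∞}
    (hW : Measurable W) (hfin : ∀ F, relaxed b W F ≠ ⊤) :
    IsGreatest (quasiconvexMinorants W) (quasiconvexEnvelope W) ∧
      quasiconvexEnvelope W = relaxed b W := by
  have h : IsGreatest (quasiconvexMinorants W) (relaxed b W) :=
    ⟨⟨isQuasiconvex_relaxed hN hW hfin, relaxed_le b W⟩, fun g hg => hg.1.le_relaxed hg.2 b⟩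
  have he : quasiconvexEnvelope W = relaxed b W := h.isLUB.sSup_eq
  exact ⟨he ▸ h, he⟩

end Quasiconvexity

theorem theoremA (m N : ℕ) (hm : 1 < m) (hN : 1 < N) (p : ℝ) (hp : 1 < p)
    (W : Mat m N → ℝ≥0∞) (hW : Measurable W) (hcoer : IsPCoercive p W) :
    ((∀ F, ZInfty W F ≠ ⊤) →
      IsGreatest (quasiconvexMinorants W) (quasiconvexEnvelope W) ∧
      quasiconvexEnvelope W = ZInfty W) ∧
    ((∀ F, ZAff W F ≠ ⊤) →
      IsGreatest (quasiconvexMinorants W) (quasiconvexEnvelope W) ∧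
      quasiconvexEnvelope W = ZAff W ∧ ZAff W = ZInfty W) := by
  have hN0 : 0 < N := by omega
  rw [ZInfty_eq_relaxed hN0, ZAff_eq_relaxed hN0]
  refine ⟨quasiconvexEnvelope_eq_relaxed hN0 hW, fun hfin => ?_⟩
  -- The class with finitely many gradients is smaller, so finiteness of its infimum passes to the
  -- other one. Both infima then equal the envelope and hence each other.
  have hle : relaxed False W ≤ relaxed True W := fun F =>
    le_iInf₂ fun φ hφ => iInf₂_le φ ⟨hφ.lip, hφ.zero, False.elim⟩
  obtain ⟨hgr, hTrue⟩ := quasiconvexEnvelope_eq_relaxed hN0 hW hfin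
  obtain ⟨-, hFalse⟩ := quasiconvexEnvelope_eq_relaxed hN0 hW
    (fun F => ne_top_of_le_ne_top (hfin F) (hle F))
  exact ⟨hgr, hTrue, hTrue.symm.trans hFalse⟩
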